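/- Let $W:\mathbb R\to\mathbb C^{N\times N}$ be a weight matrix: $W(x)$ is Hermitian positive definite for every $x$ and all its entries have finite moments of every order. Let $\widehat P_n(x)=x^nI+\sum_{j<n}a_{n,j}x^j$ be the monic matrix orthogonal polynomials, $\int\widehat P_nWQ^*\,dx=0$ for every matrix polynomial $Q$ of degree $\le n-1$, let $P_n=\kappa_n\widehat P_n$ be orthonormal, $\int P_nWP_k^*\,dx=\delta_{nk}I$, and put $\gamma_n=\kappa_n^*\kappa_n$. Put $a_{n,n}=I$, $a_{n,j}=0$ for $j<0$, $b_{n,k}=\int x^k\widehat P_n(x)W(x)\,dx$ for $k\ge n$, and $b_{n,k}=0$ for $k<n$. For a matrix function $F$ of a complex variable write $F^*(z)=(F(\bar z))^*$. Suppose that $W(x)=T(x)T(x)^*$ and $T'(x)=G(x)T(x)$ for all $x\in\mathbb R$, where $G(z)=\sum_{j=0}^mM_jz^j$ is a matrix polynomial. Then $T$ extends to an entire function, also denoted $T$, with $T(z)$ invertible for all $z\in\mathbb C$. Let $Y^n$ ($n\ge0$) be the solution of the Riemann--Hilbert problem: $Y^n:\mathbb C\setminus\mathbb R\to\mathbb C^{2N\times2N}$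 is analytic; it has continuous boundary values on $\mathbb R$ from the upper ($+$) and lower ($-$) half plane, with $Y^n_+=Y^n_-\begin{pmatrix}I&W\\0&I\end{pmatrix}$; and there are constant matrices $Y^n_i$ such that, for every $k$, $Y^n(z)=\bigl(I+\sum_{i=1}^kY^n_iz^{-i}+O(z^{-k-1})\bigr)\operatorname{diag}(z^nI,z^{-n}I)$ as $z\to\infty$ in $\mathbb C\setminus\mathbb R$. Then $X^n(z)=Y^n(z)\operatorname{diag}\bigl(T(z),(T^*(z))^{-1}\bigr)$ satisfies, for $z\in\mathbb C\setminus\mathbb R$, $$\frac{d}{dz}X^n(z)=F_n(z;G)X^n(z),\qquad F_n(z;G)=\begin{pmatrix}-\mathcal B_n(z;G)&-\frac1{2\pi i}\gamma_n^{-1}\mathcal A_n(z;G)\\2\pi i\,\mathcal A_{n-1}(z;G)\gamma_{n-1}&\mathcal B_n^*(z;G)\end{pmatrix},$$ where $$\mathcal A_n(z;G)=-\gamma_n\sum_{j=0}^{m-1}\Bigl(b_{n,n+m-j-1}\Delta_{j,n}^*(z)+\Delta_{j,n}(z)b_{n,n+m-j-1}^*\Bigr),$$ $$\mathcal B_n(z;G)=-\sum_{j=0}^{m}\Bigl(\Delta_{j,n}(z)b_{n-1,n+m-j-1}^*+b_{n,n+m-j-2}\Delta_{j,n-1}^*(z)\Bigr)\gamma_{n-1}\quad(n\ge1),$$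 $$\Delta_{j,n}(z)=\sum_{k=0}^j\widehat P_{n,k}(z)M_{m-j+k},\qquad \widehat P_{n,k}(z)=z^kI+a_{n,n-1}z^{k-1}+\dots+a_{n,n-k};$$ for $n=0$ one reads $\mathcal B_0(z;G)=-G(z)$ and takes the lower left block of $F_0$ to be $0$. Here $\mathcal A_n(\cdot;G)$ is a matrix polynomial of degree at most $m-1$ (zero if $m=0$) and $\mathcal B_n(\cdot;G)$ is a matrix polynomial of degree at most $m$. For a fixed weight, these formulas define $F_n(z;G)$ for every matrix polynomial $G$; the result does not depend on the choice of $m\ge\deg G$, and $F_n(z;G)$ is real-linear in $G$: $F_n(z;G_1+G_2)=F_n(z;G_1)+F_n(z;G_2)$ and $F_n(z;cG)=cF_n(z;G)$ for $c\in\mathbb R$. -/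

import Mathlib

open Polynomial Filter Topology Asymptotics MeasureTheory

open scoped ComplexOrder

noncomputable section

/-- Complex `N × N` matrices. -/
abbrev CMat (N : ℕ) := Matrix (Fin N) (Fin N) ℂ

/-- Complex `2N × 2N` matrices, partitioned into `N × N` blocks. -/
abbrev BMat (N : ℕ) := Matrix (Fin N ⊕ Fin N) (Fin N ⊕ Fin N) ℂ

/-- The value `∑ k, z ^ k A_k` of a matrix polynomial `∑ k, A_k X ^ k` at a scalar `z`. -/
def evalM {N : ℕ} (Q : (CMat N)[X]) (z : ℂ) : CMat N :=
  Q.sum fun k A => z ^ k • A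

/-- For a matrix function `F` of a complex variable, `F^*(z) = (F(z̄))^*`. -/
def starFun {N : ℕ} (F : ℂ → CMat N) (z : ℂ) : CMat N :=
  (F (starRingEnd ℂ z)).conjTranspose

/-- Entrywise integral over the real line. -/
def intM {N : ℕ} (F : ℝ → CMat N) : CMat N :=
  Matrix.of fun i j => ∫ x : ℝ, F x i j

/-- `(P, Q)_W = ∫ P(x) W(x) Q^*(x) dx`. -/
def innerW {N : ℕ} (W : ℝ → CMat N) (P Q : (CMat N)[X]) : CMat N :=
  intM fun x => evalM P x * W x * (evalM Q x).conjTranspose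

/-- `W` is an `N × N` weight matrix on `ℝ`: it is (Hermitian) positive definite at every point
and all its entries have finite moments of every order. -/
structure IsWeight {N : ℕ} (W : ℝ → CMat N) : Prop where
  posDef : ∀ x, (W x).PosDef
  moments : ∀ (k : ℕ) (i j : Fin N), Integrable fun x : ℝ => (x : ℂ) ^ k * W x i j

/-- `P n` is the monic matrix orthogonal polynomial of degree `n` for `W`, and `κ n` is the
leading coefficient of an orthonormal one: `(κ n * P n)` is an orthonormal sequence. -/
structure IsMOPRL {N : ℕ} (W : ℝ → CMat N) (P : ℕ → (CMat N)[X]) (κ : ℕ → CMat N) : Prop where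
  degree_le : ∀ n : ℕ, (P n).degree ≤ (n : WithBot ℕ)
  monic : ∀ n : ℕ, (P n).coeff n = 1
  orthogonal : ∀ (n : ℕ) (Q : (CMat N)[X]), Q.degree < (n : WithBot ℕ) → innerW W (P n) Q = 0
  orthonormal : ∀ n k : ℕ, innerW W (C (κ n) * P n) (C (κ k) * P k) = if n = k then 1 else 0

/-- `γ_n = κ_n^* κ_n`. -/
def gammaM {N : ℕ} (κ : ℕ → CMat N) (n : ℕ) : CMat N :=
  (κ n).conjTranspose * κ n

/-- The coefficient `a_{n,j}` of `x ^ j` in the monic polynomial `P n`; it is `0` for `j < 0`. -/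
def aCoeff {N : ℕ} (P : ℕ → (CMat N)[X]) (n : ℕ) (j : ℤ) : CMat N :=
  if j < 0 then 0 else (P n).coeff j.toNat

/-- `b_{n,k} = ∫ x ^ k P_n(x) W(x) dx` for `k ≥ n`, and `b_{n,k} = 0` for `k < n`. -/
def bCoeff {N : ℕ} (W : ℝ → CMat N) (P : ℕ → (CMat N)[X]) (n : ℕ) (k : ℤ) : CMat N :=
  if k < n then 0 else intM fun x => (x : ℂ) ^ k.toNat • (evalM (P n) x * W x)

/-- `P_{n,k}(z) = z ^ k I + a_{n,n-1} z ^ (k-1) + ⋯ + a_{n,n-k}`. -/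
def PTrunc {N : ℕ} (P : ℕ → (CMat N)[X]) (n k : ℕ) (z : ℂ) : CMat N :=
  ∑ i ∈ Finset.range (k + 1), z ^ (k - i) • aCoeff P n ((n : ℤ) - i)

/-- `Δ_{j,n}(z) = ∑_{k=0}^{j} P_{n,k}(z) M_{m-j+k}` where `G = ∑ M_k X ^ k` (used for `j ≤ m`). -/
def DeltaM {N : ℕ} (P : ℕ → (CMat N)[X]) (m : ℕ) (G : (CMat N)[X]) (j n : ℕ) (z : ℂ) : CMat N :=
  ∑ k ∈ Finset.range (j + 1), PTrunc P n k z * G.coeff (m - j + k)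

/-- `A_n(z; G)`. -/
def calA {N : ℕ} (W : ℝ → CMat N) (P : ℕ → (CMat N)[X]) (κ : ℕ → CMat N)
    (m : ℕ) (G : (CMat N)[X]) (n : ℕ) (z : ℂ) : CMat N :=
  -(gammaM κ n * ∑ j ∈ Finset.range m,
      (bCoeff W P n ((n : ℤ) + m - j - 1) * starFun (DeltaM P m G j n) z
        + DeltaM P m G j n z * (bCoeff W P n ((n : ℤ) + m - j - 1)).conjTranspose))

/-- `B_n(z; G)` for `n ≥ 1` (the case `n + 1`); and `B_0(z; G) = -G(z)`. -/
def calB {N : ℕ} (W : ℝ → CMat N) (P : ℕ → (CMat N)[X]) (κ : ℕ → CMat N)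
    (m : ℕ) (G : (CMat N)[X]) : ℕ → ℂ → CMat N
  | 0, z => -evalM G z
  | n + 1, z =>
    -((∑ j ∈ Finset.range (m + 1),
        (DeltaM P m G j (n + 1) z
            * (bCoeff W P n (((n + 1 : ℕ) : ℤ) + m - j - 1)).conjTranspose
          + bCoeff W P (n + 1) (((n + 1 : ℕ) : ℤ) + m - j - 2)
            * starFun (DeltaM P m G j n) z)) * gammaM κ n)

/-- The lower left block `2πi A_{n-1}(z; G) γ_{n-1}` of `F_n`; it is `0` for `n = 0`. -/
def lowerLeft {N : ℕ} (W : ℝ → CMat N) (P : ℕ → (CMat N)[X]) (κ : ℕ → CMat N)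
    (m : ℕ) (G : (CMat N)[X]) : ℕ → ℂ → CMat N
  | 0, _ => 0
  | n + 1, z => (2 * Real.pi * Complex.I : ℂ) • (calA W P κ m G n z * gammaM κ n)

/-- The coefficient matrix `F_n(z; G)`, for `G` regarded as a polynomial of degree at most `m`. -/
def FMat {N : ℕ} (W : ℝ → CMat N) (P : ℕ → (CMat N)[X]) (κ : ℕ → CMat N)
    (m : ℕ) (G : (CMat N)[X]) (n : ℕ) (z : ℂ) : BMat N :=
  Matrix.fromBlocks
    (-calB W P κ m G n z)
    (-((1 / (2 * Real.pi * Complex.I) : ℂ) • ((gammaM κ n)⁻¹ * calA W P κ m G n z)))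
    (lowerLeft W P κ m G n z)
    (starFun (calB W P κ m G n) z)

/-- `Y` solves the Riemann–Hilbert problem of index `n` for the weight `W` on `ℝ`: it is analytic
off the real line, has continuous boundary values `Yp`, `Ym` from the upper and the lower half
plane with `Yp = Ym * [[1, W], [0, 1]]`, and
`Y(z) diag(z^{-n}, z^n) = I + ∑_{i=1}^k Yc_i z^{-i} + O(z^{-(k+1)})` for every `k`, as `z → ∞`
off the real line. -/
structure IsRHPSolution {N : ℕ} (W : ℝ → CMat N) (n : ℕ) (Y : ℂ → BMat N) : Prop where
  analytic : ∀ i j, DifferentiableOn ℂ (fun z => Y z i j) {z : ℂ | z.im ≠ 0}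
  jump : ∃ Yp Ym : ℝ → BMat N, Continuous Yp ∧ Continuous Ym ∧
    (∀ x : ℝ, Tendsto Y (𝓝[{z : ℂ | 0 < z.im}] (x : ℂ)) (𝓝 (Yp x))) ∧
    (∀ x : ℝ, Tendsto Y (𝓝[{z : ℂ | z.im < 0}] (x : ℂ)) (𝓝 (Ym x))) ∧
    ∀ x : ℝ, Yp x = Ym x * Matrix.fromBlocks 1 (W x) 0 1
  asymptotics : ∃ Yc : ℕ → BMat N, Yc 0 = 1 ∧ ∀ (k : ℕ) (i j : Fin N ⊕ Fin N),
    (fun z : ℂ =>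
      (Y z * Matrix.fromBlocks ((z ^ n)⁻¹ • (1 : CMat N)) 0 0 (z ^ n • (1 : CMat N))
        - ∑ l ∈ Finset.range (k + 1), (z ^ l)⁻¹ • Yc l) i j)
      =O[cocompact ℂ ⊓ 𝓟 {z : ℂ | z.im ≠ 0}] fun z : ℂ => (z ^ (k + 1))⁻¹

/-- `X(z) = Y(z) diag(T(z), T^{-*}(z))`, where `T^{-*}` is the inverse of `T^*`. -/
def XFun {N : ℕ} (Y : ℂ → BMat N) (T : ℂ → CMat N) (z : ℂ) : BMat N :=
  Y z * Matrix.fromBlocks (T z) 0 0 (starFun T z)⁻¹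

end

/-! Since `W = T T^*` with `T` entire and invertible, the jump matrix continues to an entire matrix
`B`, and `Y diag(T, T^{-*})` has the constant jump `[[1, 1], [0, 1]]`. Hence the restrictions of `Y`
to the two half planes continue to entire functions `Yu` and `Yl` with `Yu = Yl B`. Put `L = diag(G,
-G^*)`. The logarithmic derivative of `X` is `R = (Y' + Y L) Y⁻¹`. It has no jump, because `B' = L B
- B L` (this is `W' = G W + W G^*`), so it is entire.

The inverse of `Y` is explicit: it is `flipFun Y`, the star of `Y` with the two blocks swapped.
Indeed `B` is flip-invariant, so `Y * flipFun Y` is entire, and it tends to `I`. The factors `2πi`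
in the off-diagonal blocks change sign under the star and play the role of the usual symplectic
signs.

At infinity, `Y' Y⁻¹` is only known to be `O(1 / |Im z|)`, because a Cauchy disc around `z` must
avoid the real line. A Liouville theorem adapted to this bound (`eq_zero_of_isBigO_inv_im`) still
shows that `R` equals any entire function that `Y L Y⁻¹` approaches with error `O(1/z)`. So it
remains to see that `F_n` is the polynomial part of `Y L Y⁻¹`.

For this the rows of `Y` are identified without Cauchy transforms. The left entry of a row is entire
of polynomial growth, hence a matrix polynomial `Q`. The right entry jumps by `Q W`, and shifting
contours in the two half planes (`HasExpansion.momW_eq`) shows that its coefficients at infinity are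
the moments of `Q W` up to the factor `-2πi`. Orthogonality then gives `P_n` in the first row and
`-2πi γ_{n-1} P_{n-1}` in the second, with the `b_{n,k}` as coefficients of the right entries.
Finally, `Δ_{j,n}` is the polynomial part of `z^{-(n+m-j)} P_n G`, so multiplying by these
expansions produces the sums in `A_n` and `B_n`. -/

/-! ### Painlevé and Liouville theorems for functions controlled off the real line. -/

/-- Neighbourhoods of infinity in `ℂ ∖ ℝ`. -/
noncomputable abbrev offReal : Filter ℂ := cocompact ℂ ⊓ 𝓟 {z : ℂ | z.im ≠ 0}

theorem dense_im_ne_zero : Dense {z : ℂ | z.im ≠ 0} := by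
  have h : {z : ℂ | z.im ≠ 0} = (Complex.im ⁻¹' {0})ᶜ := by ext; simp
  rw [h, ← interior_eq_empty_iff_dense_compl, Complex.interior_preimage_im, interior_singleton]
  simp

theorem isOpen_im_ne_zero : IsOpen {z : ℂ | z.im ≠ 0} :=
  isOpen_ne_fun Complex.continuous_im continuous_const

/-- Painlevé's theorem: a continuous function that is holomorphic off the real line is entire. -/
theorem Continuous.differentiable_of_off_real {g : ℂ → ℂ} (hc : Continuous g)
    (hd : DifferentiableOn ℂ g {z | z.im ≠ 0}) : Differentiable ℂ g := by
  rw [← differentiableOn_univ, ← Complex.isConservativeOn_and_continuousOn_iff_isDifferentiableOn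
    isOpen_univ]
  refine ⟨fun z w _ => ?_, hc.continuousOn⟩
  rw [← add_eq_zero_iff_eq_neg, Complex.wedgeIntegral_add_wedgeIntegral_eq]
  -- Morera: a rectangle is cut along the real axis. Each half meets the axis only in its boundary,
  -- where continuity suffices for Cauchy's theorem.
  have key : ∀ a b c d : ℝ, (b = 0 ∨ d = 0) →
      (∫ x : ℝ in a..c, g (x + b * Complex.I)) - (∫ x : ℝ in a..c, g (x + d * Complex.I)) +
      Complex.I • (∫ y : ℝ in b..d, g (c + y * Complex.I)) -
      Complex.I • (∫ y : ℝ in b..d, g (a + y * Complex.I)) = 0 := by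
    intro a b c d hbd
    refine Complex.integral_boundary_rect_eq_zero_of_continuousOn_of_differentiableOn g
      ⟨a, b⟩ ⟨c, d⟩ hc.continuousOn (hd.mono ?_)
    rintro ζ hζ h0
    have := hζ.2
    simp only [Set.mem_preimage, h0, Set.mem_Ioo] at this
    rcases hbd with rfl | rfl <;> grind
  have h1 := key z.re z.im w.re 0 (Or.inr rfl)
  have h2 := key z.re 0 w.re w.im (Or.inl rfl)
  have hi : ∀ a b c : ℝ, (∫ y : ℝ in b..0, g (a + y * Complex.I)) +
      (∫ y : ℝ in 0..c, g (a + y * Complex.I)) = ∫ y : ℝ in b..c, g (a + y * Complex.I) := by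
    intro a b c
    have hc' : Continuous fun y : ℝ => g (a + y * Complex.I) := hc.comp (by fun_prop)
    exact intervalIntegral.integral_add_adjacent_intervals (hc'.intervalIntegrable _ _)
      (hc'.intervalIntegrable _ _)
  rw [← hi w.re, ← hi z.re]
  simp only [smul_eq_mul] at *
  linear_combination h1 + h2

/-- A holomorphic function off the real line whose one-sided boundary values agree extends to an
entire function. -/
theorem exists_entire_extension {f : ℂ → ℂ} (hf : DifferentiableOn ℂ f {z | z.im ≠ 0})
    (h : ∀ x : ℝ, ∃ l, Tendsto f (𝓝[{z : ℂ | 0 < z.im}] (x : ℂ)) (𝓝 l) ∧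
      Tendsto f (𝓝[{z : ℂ | z.im < 0}] (x : ℂ)) (𝓝 l)) :
    ∃ g : ℂ → ℂ, Differentiable ℂ g ∧ ∀ z : ℂ, z.im ≠ 0 → g z = f z := by
  have heq : ∀ z : ℂ, z.im ≠ 0 → extendFrom {z : ℂ | z.im ≠ 0} f z = f z := fun z hz =>
    extendFrom_extends hf.continuousOn z hz
  have hc : Continuous (extendFrom {z : ℂ | z.im ≠ 0} f) := by
    refine continuous_extendFrom dense_im_ne_zero fun z => ?_
    by_cases hz : z.im = 0
    · obtain ⟨l, h1, h2⟩ := h z.re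
      have hz' : (z.re : ℂ) = z := Complex.ext rfl (by simp [hz])
      rw [hz'] at h1 h2
      refine ⟨l, ?_⟩
      have hu : {z : ℂ | z.im ≠ 0} = {z : ℂ | 0 < z.im} ∪ {z : ℂ | z.im < 0} := by
        ext w; exact ne_iff_lt_or_gt.trans or_comm
      rw [hu, nhdsWithin_union]
      exact h1.sup h2
    · exact ⟨f z, hf.continuousOn z hz⟩
  exact ⟨_, hc.differentiable_of_off_real (hf.congr heq), heq⟩

/-- On the circle `r² = z z̄`, so `z² - r² = z (z - z̄)`. Multiplying by `z² - r²` therefore cancels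
a factor `1 / |Im z|` on `‖z‖ = r`. -/
theorem norm_sq_sub_norm_sq {z : ℂ} {r : ℝ} (hz : ‖z‖ = r) :
    ‖z ^ 2 - (r : ℂ) ^ 2‖ = 2 * r * |z.im| := by
  have h : (r : ℂ) ^ 2 = z * starRingEnd ℂ z := by
    rw [Complex.mul_conj, Complex.normSq_eq_norm_sq, hz]; push_cast; rfl
  have h2 : z ^ 2 - (r : ℂ) ^ 2 = z * (2 * z.im * Complex.I) := by
    rw [h, show z ^ 2 - z * starRingEnd ℂ z = z * (z - starRingEnd ℂ z) by ring, Complex.sub_conj]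
    push_cast; ring
  rw [h2]; simp [hz]; ring

/-- An entire function that is `O(1 / |Im z|)` at infinity off the real line vanishes. -/
theorem eq_zero_of_isBigO_inv_im {E : ℂ → ℂ} (hE : Differentiable ℂ E)
    (h : E =O[offReal] fun z => ((z.im : ℂ))⁻¹) : E = 0 := by
  obtain ⟨C, hC⟩ := h.bound
  rw [eventually_inf_principal, ← Metric.cobounded_eq_cocompact, ← comap_norm_atTop, eventually_comap, eventually_atTop] at hC
  obtain ⟨R, hR⟩ := hC
  have hb : ∀ z : ℂ, R ≤ ‖z‖ → ‖E z‖ * |z.im| ≤ |C| := by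
    intro z hz
    by_cases h0 : z.im = 0
    · simp [h0]
    · have := hR ‖z‖ hz z rfl h0
      rw [norm_inv, Complex.norm_real, Real.norm_eq_abs, ← div_eq_mul_inv,
        le_div_iff₀ (abs_pos.2 h0)] at this
      exact this.trans (le_abs_self C)
  have hr : ∀ r : ℝ, 0 < r → R ≤ r → ∀ z : ℂ, ‖z‖ ≤ r / 2 → ‖E z‖ ≤ 4 * |C| / r := by
    intro r hr0 hRr z hz
    -- The zeros `±r` of the multiplier are the points where the circle meets the real axis, the
    -- only places where the bound on `E` degenerates. The maximum principle carries the bound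
    -- inside, where on `‖z‖ ≤ r / 2` the multiplier is still at least `3 r² / 4`.
    have hd : Differentiable ℂ fun z => (z ^ 2 - (r : ℂ) ^ 2) * E z := by fun_prop
    have hmax : ‖(z ^ 2 - (r : ℂ) ^ 2) * E z‖ ≤ 2 * r * |C| := by
      refine Complex.norm_le_of_forall_mem_frontier_norm_le (U := Metric.ball 0 r)
        Metric.isBounded_ball hd.diffContOnCl (fun w hw => ?_) (subset_closure ?_)
      · rw [frontier_ball _ hr0.ne', mem_sphere_zero_iff_norm] at hw
        rw [norm_mul, norm_sq_sub_norm_sq hw, mul_assoc (2 * r), mul_comm |w.im|]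
        exact mul_le_mul_of_nonneg_left (hb w (hw ▸ hRr)) (by positivity)
      · rw [mem_ball_zero_iff]; linarith
    have hlow : 3 / 4 * r ^ 2 ≤ ‖z ^ 2 - (r : ℂ) ^ 2‖ := by
      have h1 := norm_sub_norm_le ((r : ℂ) ^ 2) (z ^ 2)
      rw [norm_sub_rev, norm_pow, norm_pow, Complex.norm_real, Real.norm_of_nonneg hr0.le] at h1
      have : ‖z‖ ^ 2 ≤ (r / 2) ^ 2 := by gcongr
      nlinarith
    rw [norm_mul] at hmax
    have h2 : 3 / 4 * r ^ 2 * ‖E z‖ ≤ 2 * r * |C| :=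
      (mul_le_mul_of_nonneg_right hlow (norm_nonneg _)).trans hmax
    rw [le_div_iff₀ hr0]
    have h3 : r * (3 / 4 * (‖E z‖ * r)) ≤ r * (2 * |C|) := by linarith
    have h4 := le_of_mul_le_mul_left h3 hr0
    have := abs_nonneg C
    linarith
  funext z
  have hlim : Tendsto (fun r : ℝ => 4 * |C| / r) atTop (𝓝 0) := tendsto_const_nhds.div_atTop tendsto_id
  have : ‖E z‖ ≤ 0 := by
    refine ge_of_tendsto hlim ?_
    filter_upwards [eventually_gt_atTop 0, eventually_ge_atTop R, eventually_ge_atTop (2 * ‖z‖)]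
      with r h1 h2 h3
    exact hr r h1 h2 z (by linarith)
  simpa using this

/-! ### A residue at infinity as an integral over the real line. -/

/-- Allows `c / z` to be replaced by `c / (z + i)`, whose pole lies outside the closed upper half
plane, at the cost of an `O(z⁻²)` error. -/
theorem inv_sub_inv_add_I_bound {z : ℂ} (hz : 0 < z.im) :
    ‖z⁻¹ - (z + Complex.I)⁻¹‖ ≤ (‖z‖ ^ 2)⁻¹ := by
  have hz0 : z ≠ 0 := by rintro rfl; simp at hz
  have hzI : z + Complex.I ≠ 0 := by
    intro h
    have := congrArg Complex.im h
    simp at this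
    linarith
  have hle : ‖z‖ ≤ ‖z + Complex.I‖ := by
    rw [← sq_le_sq₀ (norm_nonneg _) (norm_nonneg _), ← Complex.normSq_eq_norm_sq,
      ← Complex.normSq_eq_norm_sq, Complex.normSq_apply, Complex.normSq_apply]
    simp
    nlinarith
  rw [show z⁻¹ - (z + Complex.I)⁻¹ = Complex.I * (z * (z + Complex.I))⁻¹ by
    field_simp; ring, norm_mul, Complex.norm_I, one_mul, norm_inv, norm_mul, sq]
  have := norm_pos_iff.2 hz0
  gcongr

/-- Cauchy's theorem on `[-R, R] × [0, R]`: the other three sides have total length `4R`, and the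
integrand there is at most `C / R²`. -/
theorem norm_rect_upper_le {v : ℂ → ℂ} {C R : ℝ} (hR : 0 < R)
    (hd : DifferentiableOn ℂ v {z | 0 ≤ z.im})
    (hv : ∀ z : ℂ, 0 < z.im → R ≤ ‖z‖ → ‖v z‖ ≤ C * (‖z‖ ^ 2)⁻¹) (hC : 0 ≤ C) :
    ‖∫ x : ℝ in -R..R, v x‖ ≤ 4 * C / R := by
  have hb : ∀ z : ℂ, 0 < z.im → R ≤ ‖z‖ → ‖v z‖ ≤ C / R ^ 2 := fun z h1 h2 =>
    (hv z h1 h2).trans (by rw [← div_eq_mul_inv]; gcongr)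
  have key := Complex.integral_boundary_rect_eq_zero_of_differentiableOn v ⟨-R, 0⟩ ⟨R, R⟩
    (hd.mono fun z hz => by
      have := hz.2
      simp only [Set.mem_preimage, Set.uIcc_of_le hR.le] at this
      exact this.1)
  simp only [smul_eq_mul, Complex.ofReal_zero, zero_mul, add_zero] at key
  have h1 : ‖∫ x : ℝ in -R..R, v (x + R * Complex.I)‖ ≤ C / R ^ 2 * |R - -R| := by
    refine intervalIntegral.norm_integral_le_of_norm_le_const fun x _ => hb _ (by simpa) ?_
    refine le_trans ?_ (Complex.abs_im_le_norm _)
    simp [abs_of_pos hR]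
  have h2 : ∀ a : ℝ, |a| = R → ‖∫ y : ℝ in 0..R, v (a + y * Complex.I)‖ ≤ C / R ^ 2 * |R - 0| := by
    intro a ha
    refine intervalIntegral.norm_integral_le_of_norm_le_const fun x hx => hb _ ?_ ?_
    · rw [Set.uIoc_of_le hR.le] at hx
      simpa using hx.1
    · refine le_trans ?_ (Complex.abs_re_le_norm _)
      simp [ha]
  have h3 := h2 R (abs_of_pos hR)
  have h4 := h2 (-R) (by rw [abs_neg, abs_of_pos hR])
  have e : (∫ x : ℝ in -R..R, v x) = (∫ x : ℝ in -R..R, v (x + R * Complex.I))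
      - Complex.I * (∫ y : ℝ in 0..R, v (R + y * Complex.I))
      + Complex.I * (∫ y : ℝ in 0..R, v ((-R : ℝ) + y * Complex.I)) := by
    linear_combination key
  rw [e]
  refine (norm_add_le _ _).trans ?_
  refine (add_le_add_left (norm_sub_le _ _) _).trans ?_
  rw [norm_mul, norm_mul, Complex.norm_I, one_mul, one_mul]
  rw [sub_neg_eq_add, abs_of_pos (by linarith : 0 < R + R)] at h1
  rw [sub_zero, abs_of_pos hR] at h3 h4
  have : 4 * C / R = C / R ^ 2 * (R + R) + C / R ^ 2 * R + C / R ^ 2 * R := by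
    field_simp; ring
  linarith

/-- Only the symmetric limit exists. Averaging the integrand over `x` and `-x` gives `-i / (1 +
x²)`, hence an arctangent. -/
theorem tendsto_integral_inv_add_I :
    Tendsto (fun R : ℝ => ∫ x : ℝ in -R..R, ((x : ℂ) + Complex.I)⁻¹) atTop
      (𝓝 (-(Real.pi * Complex.I))) := by
  have hne : ∀ x : ℝ, (x : ℂ) + Complex.I ≠ 0 := fun x h => by
    have := congrArg Complex.im h
    simp at this
  have h : ∀ R : ℝ, ∫ x : ℝ in -R..R, ((x : ℂ) + Complex.I)⁻¹
      = -(2 * Real.arctan R : ℝ) * Complex.I := by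
    intro R
    have hi : ∀ a b : ℝ, IntervalIntegrable (fun x : ℝ => ((x : ℂ) + Complex.I)⁻¹) volume a b :=
      fun a b => Continuous.intervalIntegrable (by fun_prop (disch := exact hne _)) _ _
    have h1 : ∫ x : ℝ in -R..R, ((x : ℂ) + Complex.I)⁻¹
        = ∫ x : ℝ in -R..R, -((x : ℂ) - Complex.I)⁻¹ := by
      have := intervalIntegral.integral_comp_neg (a := -R) (b := R)
        fun x : ℝ => ((x : ℂ) + Complex.I)⁻¹
      rw [neg_neg] at this
      rw [← this]
      congr 1; funext x
      rw [← inv_neg]; push_cast; congr 1; ring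
    have hne' : ∀ x : ℝ, (x : ℂ) - Complex.I ≠ 0 := fun x h => by
      have := congrArg Complex.im h
      simp at this
    have hi' : IntervalIntegrable (fun x : ℝ => -((x : ℂ) - Complex.I)⁻¹) volume (-R) R :=
      Continuous.intervalIntegrable (by fun_prop (disch := exact hne' _)) _ _
    have h2 : (∫ x : ℝ in -R..R, ((x : ℂ) + Complex.I)⁻¹) +
        (∫ x : ℝ in -R..R, -((x : ℂ) - Complex.I)⁻¹) =
        ∫ x : ℝ in -R..R, ((1 / (1 + x ^ 2) : ℝ) : ℂ) * (-2 * Complex.I) := by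
      rw [← intervalIntegral.integral_add (hi _ _) hi']
      congr 1; funext x
      have : (1 : ℂ) + x ^ 2 ≠ 0 := by
        exact_mod_cast (by positivity : (1 : ℝ) + x ^ 2 ≠ 0)
      have h3 := hne x
      have h4 := hne' x
      push_cast
      field_simp
      linear_combination (-2 * Complex.I ^ 1 : ℂ) * Complex.I_sq
    rw [intervalIntegral.integral_mul_const, intervalIntegral.integral_ofReal,
      integral_one_div_one_add_sq, ← h1, Real.arctan_neg] at h2
    push_cast at h2 ⊢
    linear_combination h2 / 2
  simp_rw [h]
  have h2 : Tendsto (fun R : ℝ => 2 * Real.arctan R) atTop (𝓝 (2 * (Real.pi / 2))) :=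
    ((Real.tendsto_arctan_atTop).mono_right nhdsWithin_le_nhds).const_mul 2
  rw [mul_div_cancel₀ _ two_ne_zero] at h2
  have h3 := ((Complex.continuous_ofReal.tendsto _).comp h2).neg.mul_const Complex.I
  rw [neg_mul] at h3
  exact h3

/-- Half of the residue at infinity, as an integral over the real line. -/
theorem tendsto_integral_of_upper {u : ℂ → ℂ} (hu : Differentiable ℂ u) {c : ℂ}
    (h : (fun z => u z - c * z⁻¹) =O[cocompact ℂ ⊓ 𝓟 {z : ℂ | 0 < z.im}] fun z => (z ^ 2)⁻¹) :
    Tendsto (fun R : ℝ => ∫ x : ℝ in -R..R, u x) atTop (𝓝 (-(Real.pi * Complex.I * c))) := by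
  have hne : ∀ z : ℂ, 0 ≤ z.im → z + Complex.I ≠ 0 := fun z hz h => by
    have := congrArg Complex.im h
    simp at this
    linarith
  obtain ⟨C, hC0, hC⟩ := h.exists_nonneg
  have hC := hC.bound
  rw [eventually_inf_principal, ← Metric.cobounded_eq_cocompact, ← comap_norm_atTop,
    eventually_comap, eventually_atTop] at hC
  obtain ⟨R, hR⟩ := hC
  have hlim : Tendsto (fun R : ℝ => ∫ x : ℝ in -R..R, (u x - c * ((x : ℂ) + Complex.I)⁻¹)) atTop
      (𝓝 0) := by
    refine squeeze_zero_norm' (a := fun r : ℝ => 4 * (C + ‖c‖) / r) ?_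
      (tendsto_const_nhds.div_atTop tendsto_id)
    filter_upwards [eventually_gt_atTop 0, eventually_ge_atTop R] with r hr0 hrR
    refine norm_rect_upper_le (v := fun z => u z - c * (z + Complex.I)⁻¹) hr0 ?_ ?_ (by positivity)
    · intro z hz
      have := hne z hz
      exact ((hu z).sub ((differentiableAt_const c).mul
        ((differentiableAt_id.add (differentiableAt_const _)).inv this))).differentiableWithinAt
    · intro z hz hrz
      have h1 := hR ‖z‖ (hrR.trans hrz) z rfl hz
      have h2 := inv_sub_inv_add_I_bound hz
      rw [norm_inv, norm_pow] at h1
      calc ‖u z - c * (z + Complex.I)⁻¹‖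
          = ‖(u z - c * z⁻¹) + c * (z⁻¹ - (z + Complex.I)⁻¹)‖ := by congr 1; ring
        _ ≤ C * (‖z‖ ^ 2)⁻¹ + ‖c‖ * (‖z‖ ^ 2)⁻¹ := by
          refine (norm_add_le _ _).trans (add_le_add h1 ?_)
          rw [norm_mul]; gcongr
        _ = _ := by ring
  have hsum := hlim.add (tendsto_integral_inv_add_I.const_mul c)
  have e : ∀ r : ℝ, (∫ x : ℝ in -r..r, (u x - c * ((x : ℂ) + Complex.I)⁻¹)) +
      c * (∫ x : ℝ in -r..r, ((x : ℂ) + Complex.I)⁻¹) = ∫ x : ℝ in -r..r, u x := by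
    intro r
    have hcu : Continuous fun x : ℝ => u x := hu.continuous.comp Complex.continuous_ofReal
    have hcv : Continuous fun x : ℝ => c * ((x : ℂ) + Complex.I)⁻¹ := by
      have hne' : ∀ x : ℝ, (x : ℂ) + Complex.I ≠ 0 := fun x => hne x (by simp)
      exact continuous_const.mul (Continuous.inv₀ (by fun_prop) hne')
    rw [intervalIntegral.integral_sub (hcu.intervalIntegrable _ _) (hcv.intervalIntegrable _ _),
      intervalIntegral.integral_const_mul]
    ring
  simp_rw [e] at hsum
  convert hsum using 2
  ring

/-- If `u` and `l` are entire and equal `c / z + O(z⁻²)` at infinity in the upper and in the lower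
half plane respectively, then `∫ (u - l) = -2πi c`. -/
theorem integral_sub_eq_residue {u l : ℂ → ℂ} (hu : Differentiable ℂ u) (hl : Differentiable ℂ l)
    {c : ℂ}
    (h₁ : (fun z => u z - c * z⁻¹) =O[cocompact ℂ ⊓ 𝓟 {z : ℂ | 0 < z.im}] fun z => (z ^ 2)⁻¹)
    (h₂ : (fun z => l z - c * z⁻¹) =O[cocompact ℂ ⊓ 𝓟 {z : ℂ | z.im < 0}] fun z => (z ^ 2)⁻¹)
    (hi : Integrable fun x : ℝ => u x - l x) :
    ∫ x : ℝ, (u x - l x) = -(2 * Real.pi * Complex.I * c) := by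
  have t1 := tendsto_integral_of_upper hu h₁
  -- The lower half plane is reflected to the upper one by `z ↦ -z`, which turns `c` into `-c`; the
  -- two half-residues then add up.
  have hneg : Tendsto (fun z : ℂ => -z) (cocompact ℂ ⊓ 𝓟 {z : ℂ | 0 < z.im})
      (cocompact ℂ ⊓ 𝓟 {z : ℂ | z.im < 0}) := by
    refine ((Homeomorph.neg ℂ).isClosedEmbedding.tendsto_cocompact).inf ?_
    rw [tendsto_principal_principal]
    intro z hz
    simpa using hz
  have t2 : Tendsto (fun R : ℝ => ∫ x : ℝ in -R..R, l (-x)) atTop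
      (𝓝 (-(Real.pi * Complex.I * -c))) := by
    have hd : Differentiable ℂ fun z => l (-z) := hl.comp differentiable_neg
    refine tendsto_integral_of_upper hd ?_
    have := h₂.comp_tendsto hneg
    simpa [Function.comp_def, inv_neg] using this
  have e : ∀ R : ℝ, (∫ x : ℝ in -R..R, u x) - (∫ x : ℝ in -R..R, l (-x))
      = ∫ x : ℝ in -R..R, (u x - l x) := by
    intro R
    have h3 := intervalIntegral.integral_comp_neg (a := -R) (b := R) fun x : ℝ => l x
    simp only [Complex.ofReal_neg, neg_neg] at h3
    rw [h3, intervalIntegral.integral_sub]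
    · exact (hu.continuous.comp Complex.continuous_ofReal).intervalIntegrable _ _
    · exact (hl.continuous.comp Complex.continuous_ofReal).intervalIntegrable _ _
  have t3 := t1.sub t2
  simp_rw [e] at t3
  -- Only the difference `u - l` is assumed integrable; `u` and `l` separately have limits over
  -- symmetric intervals only.
  have t4 := intervalIntegral_tendsto_integral hi tendsto_neg_atTop_atBot tendsto_id
  rw [tendsto_nhds_unique t4 t3]
  ring

/-! ### Entire solutions of linear differential equations with polynomial coefficients. -/

section LinearODE

variable {E : Type*} [NormedAddCommGroup E] [NormedSpace ℂ E]

/-- Taylor coefficients at `0` of the solution of `x' = ∑ z ^ j A_j x`, `x(0) = x₀`. -/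
noncomputable def odeCoeff (A : ℕ → E →L[ℂ] E) (x₀ : E) : ℕ → E
  | 0 => x₀
  | k + 1 => ((k : ℂ) + 1)⁻¹ • ∑ j : Fin (k + 1), A j (odeCoeff A x₀ (k - j))
decreasing_by omega

theorem smul_odeCoeff_succ (A : ℕ → E →L[ℂ] E) (x₀ : E) (k : ℕ) :
    ((k : ℂ) + 1) • odeCoeff A x₀ (k + 1)
      = ∑ j ∈ Finset.range (k + 1), A j (odeCoeff A x₀ (k - j)) := by
  rw [odeCoeff, smul_inv_smul₀ (by exact_mod_cast k.succ_ne_zero),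
    Finset.sum_range fun j => A j (odeCoeff A x₀ (k - j))]

/-- The weighted terms `t_k = ‖c_k‖ R^k` satisfy `(k + 1) t_{k+1} ≤ K max_{i ≤ k} t_i`, where `K` is
finite because only `m + 1` of the `A_j` are nonzero. Once `k + 1 ≥ K` the running maximum cannot
grow, so the initial terms bound everything. As `R` is arbitrary, the series has infinite radius of
convergence. -/
theorem odeCoeff_bounded (A : ℕ → E →L[ℂ] E) {m : ℕ} (hA : ∀ j, m < j → A j = 0) (x₀ : E)
    {R : ℝ} (hR : 0 < R) : ∃ C, ∀ k, ‖odeCoeff A x₀ k‖ * R ^ k ≤ C := by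
  set c := odeCoeff A x₀ with hc
  set K := ∑ j ∈ Finset.range (m + 1), ‖A j‖ * R ^ (j + 1) with hK
  obtain ⟨k₀, hk₀⟩ := exists_nat_ge K
  set C := ∑ i ∈ Finset.range (k₀ + 1), ‖c i‖ * R ^ i with hC
  have hC0 : 0 ≤ C := Finset.sum_nonneg fun i _ => by positivity
  refine ⟨C, fun k => ?_⟩
  induction k using Nat.strong_induction_on with
  | _ k ih =>
    by_cases hk : k ≤ k₀
    · exact Finset.single_le_sum (f := fun i => ‖c i‖ * R ^ i) (fun i _ => by positivity)
        (Finset.mem_range.2 (by omega))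
    · obtain ⟨k, rfl⟩ : ∃ l, k = l + 1 := ⟨k - 1, by omega⟩
      have h1 : ((k : ℝ) + 1) * ‖c (k + 1)‖ ≤
          ∑ j ∈ Finset.range (k + 1), ‖A j‖ * ‖c (k - j)‖ := by
        have := smul_odeCoeff_succ A x₀ k
        have h2 := congrArg norm this
        rw [norm_smul, show ‖(k : ℂ) + 1‖ = (k : ℝ) + 1 by
          exact_mod_cast Complex.norm_natCast (k + 1)] at h2
        rw [h2]
        exact (norm_sum_le _ _).trans (Finset.sum_le_sum fun j _ => (A j).le_opNorm _)
      have h3 : ((k : ℝ) + 1) * (‖c (k + 1)‖ * R ^ (k + 1)) ≤ K * C := by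
        calc ((k : ℝ) + 1) * (‖c (k + 1)‖ * R ^ (k + 1))
            ≤ (∑ j ∈ Finset.range (k + 1), ‖A j‖ * ‖c (k - j)‖) * R ^ (k + 1) := by
              rw [← mul_assoc]; gcongr
          _ = ∑ j ∈ Finset.range (k + 1), (‖A j‖ * R ^ (j + 1)) * (‖c (k - j)‖ * R ^ (k - j)) := by
              rw [Finset.sum_mul]
              refine Finset.sum_congr rfl fun j hj => ?_
              rw [Finset.mem_range] at hj
              rw [show k + 1 = (j + 1) + (k - j) by omega, pow_add]
              ring
          _ ≤ ∑ j ∈ Finset.range (k + 1), (‖A j‖ * R ^ (j + 1)) * C := by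
              refine Finset.sum_le_sum fun j _ => ?_
              have := ih (k - j) (by omega)
              gcongr
          _ ≤ K * C := by
              rw [← Finset.sum_mul]
              refine mul_le_mul_of_nonneg_right ?_ hC0
              rw [hK, ← Finset.sum_filter_of_ne (p := fun j => j < m + 1)]
              · refine Finset.sum_le_sum_of_subset_of_nonneg (fun j hj => ?_)
                  fun j _ _ => by positivity
                simpa using (Finset.mem_filter.1 hj).2
              · intro j _ hj
                by_contra h
                exact hj (by rw [hA j (by omega)]; simp)
      have h4 : K * C ≤ ((k : ℝ) + 1) * C := by
        refine mul_le_mul_of_nonneg_right ?_ hC0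
        have : (k₀ : ℝ) ≤ k + 1 := by exact_mod_cast (by omega : k₀ ≤ k + 1)
        linarith
      exact le_of_mul_le_mul_left (h3.trans h4) (by positivity)

/-- A linear differential equation with polynomial coefficients has an entire solution. -/
theorem exists_entire_solution [CompleteSpace E] (A : ℕ → E →L[ℂ] E) {m : ℕ}
    (hA : ∀ j, m < j → A j = 0) (x₀ : E) :
    ∃ x : ℂ → E, x 0 = x₀ ∧
      ∀ z, HasDerivAt x (∑ j ∈ Finset.range (m + 1), z ^ j • A j (x z)) z := by
  set c := odeCoeff A x₀ with hc
  have hu : ∀ R : ℝ, 0 < R → Summable fun k : ℕ => (k : ℝ) * R ^ (k - 1) * ‖c k‖ := by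
    intro R hR
    -- Boundedness at the doubled radius leaves a factor `2^{-k}`, which absorbs the `k` coming from
    -- differentiation.
    obtain ⟨C, hC⟩ := odeCoeff_bounded A hA x₀ (R := 2 * R) (by positivity)
    have hg : Summable fun k : ℕ => C / R * ((k : ℝ) * (1 / 2 : ℝ) ^ k) := by
      have h := summable_pow_mul_geometric_of_norm_lt_one (R := ℝ) 1 (r := 1 / 2) (by norm_num)
      simp only [pow_one] at h
      exact h.mul_left _
    refine Summable.of_nonneg_of_le (fun k => by positivity) (fun k => ?_) hg
    rcases k with _ | k
    · simp
    · have := hC (k + 1)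
      rw [mul_pow] at this
      have h2 : ‖c (k + 1)‖ * R ^ (k + 1) ≤ C * (1 / 2) ^ (k + 1) := by
        rw [one_div, inv_pow, ← div_eq_mul_inv, le_div_iff₀ (by positivity)]
        linarith
      calc ((k + 1 : ℕ) : ℝ) * R ^ (k + 1 - 1) * ‖c (k + 1)‖
          = ((k + 1 : ℕ) : ℝ) / R * (‖c (k + 1)‖ * R ^ (k + 1)) := by
            rw [Nat.add_sub_cancel]; field_simp; ring
        _ ≤ ((k + 1 : ℕ) : ℝ) / R * (C * (1 / 2) ^ (k + 1)) := by gcongr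
        _ = _ := by ring
  have hd : ∀ z, HasDerivAt (fun z => ∑' k, z ^ k • c k)
      (∑' k : ℕ, ((k : ℂ) * z ^ (k - 1)) • c k) z := by
    intro z
    have hR : 0 < ‖z‖ + 1 := by positivity
    refine hasDerivAt_tsum_of_isPreconnected (t := Metric.ball (0 : ℂ) (‖z‖ + 1)) (y₀ := 0)
      (g := fun k z => z ^ k • c k) (g' := fun k z => ((k : ℂ) * z ^ (k - 1)) • c k)
      (hu _ hR) Metric.isOpen_ball
      (convex_ball _ _).isPreconnected (fun k y _ => (hasDerivAt_pow k y).smul_const _)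
      (fun k y hy => ?_) (by simpa using hR) ?_ (by simp)
    · rw [mem_ball_zero_iff] at hy
      rw [norm_smul, norm_mul, norm_pow, Complex.norm_natCast]
      gcongr
    · refine summable_of_ne_finset_zero (s := {0}) fun k hk => ?_
      simp at hk
      simp [hk]
  have hs : ∀ z : ℂ, Summable fun k : ℕ => z ^ k • c k := by
    intro z
    obtain ⟨C, hC⟩ := odeCoeff_bounded A hA x₀ (R := 2 * (‖z‖ + 1)) (by positivity)
    have hg : Summable fun k : ℕ => C * (1 / 2 : ℝ) ^ k :=
      (summable_geometric_of_lt_one (by norm_num) (by norm_num)).mul_left _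
    refine Summable.of_norm_bounded hg fun k => ?_
    have h1 := hC k
    rw [one_div, inv_pow, ← div_eq_mul_inv, le_div_iff₀ (by positivity), norm_smul, norm_pow]
    refine le_trans ?_ h1
    rw [mul_pow, mul_comm (‖z‖ ^ k), mul_assoc, mul_comm (2 ^ k : ℝ)]
    gcongr
    linarith
  refine ⟨fun z => ∑' k, z ^ k • c k, ?_, fun z => ?_⟩
  · show ∑' k, (0 : ℂ) ^ k • c k = x₀
    rw [tsum_eq_single 0 fun k hk => by simp [hk]]
    simp [hc, odeCoeff]
  · convert hd z using 1
    -- Each term is reindexed to start at `k = j`, so that the sum over `j` can be collected power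
    -- by power and compared with the recurrence.
    have hj : ∀ j ∈ Finset.range (m + 1), HasSum
        (fun k => if j ≤ k then z ^ k • A j (c (k - j)) else 0)
        (z ^ j • A j (∑' k, z ^ k • c k)) := by
      intro j _
      have h1 := ((A j).hasSum (hs z).hasSum).const_smul (z ^ j)
      have hinj : Function.Injective fun k : ℕ => k + j := add_left_injective j
      rw [← hinj.hasSum_iff]
      · convert h1 using 1
        funext k
        simp [pow_add, mul_smul, smul_comm (z ^ k)]
      · intro k hk
        rw [if_neg]
        intro h
        exact hk ⟨k - j, by simp [h]⟩
    have h2 := hasSum_sum hj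
    have h3 : ∀ k : ℕ, (∑ j ∈ Finset.range (m + 1),
        if j ≤ k then z ^ k • A j (c (k - j)) else 0) = (((k + 1 : ℕ) : ℂ) * z ^ k) • c (k + 1) := by
      intro k
      rw [mul_comm, mul_smul, Nat.cast_add, Nat.cast_one, hc, smul_odeCoeff_succ, ← hc,
        Finset.smul_sum, ← Finset.sum_filter]
      refine Finset.sum_subset_zero_on_sdiff (fun j hj => ?_) (fun j hj => ?_) fun _ _ => rfl
      · simp at hj ⊢; omega
      · have : m < j := by simp at hj; omega
        simp [hA j this]
    simp_rw [h3] at h2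
    have h4 : HasSum (fun k : ℕ => ((k : ℂ) * z ^ (k - 1)) • c k)
        (∑ j ∈ Finset.range (m + 1), z ^ j • A j (∑' k, z ^ k • c k)) := by
      rw [← hasSum_nat_add_iff' 1]
      simpa using h2
    exact h4.tsum_eq.symm

end LinearODE

/-! ### Entrywise differentiation and the entire continuation of `T`. -/

section EntrywiseDerivative

variable {𝕜 : Type*} [NontriviallyNormedField 𝕜] [NormedAlgebra 𝕜 ℂ]
  {ι κ μ : Type*}

/-- The matrix function `F` has derivative `F'` at `z`, entry by entry. -/
def HasEDerivAt (F : 𝕜 → Matrix ι κ ℂ) (F' : Matrix ι κ ℂ) (z : 𝕜) : Prop :=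
  ∀ i j, HasDerivAt (fun w => F w i j) (F' i j) z

theorem HasEDerivAt.mul [Fintype κ] {F : 𝕜 → Matrix ι κ ℂ} {H : 𝕜 → Matrix κ μ ℂ} {F' H' z}
    (hF : HasEDerivAt F F' z) (hH : HasEDerivAt H H' z) :
    HasEDerivAt (fun w => F w * H w) (F' * H z + F z * H') z := by
  intro i j
  simp only [Matrix.mul_apply, Matrix.add_apply, ← Finset.sum_add_distrib]
  exact HasDerivAt.fun_sum fun k _ => (hF i k).mul (hH k j)

theorem HasEDerivAt.const (A : Matrix ι κ ℂ) (z : 𝕜) :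
    HasEDerivAt (fun _ : 𝕜 => A) (0 : Matrix ι κ ℂ) z := fun _ _ => hasDerivAt_const z _

theorem HasEDerivAt.comp_ofReal {F : ℂ → Matrix ι κ ℂ} {F' : Matrix ι κ ℂ} {x : ℝ}
    (h : HasEDerivAt F F' (x : ℂ)) : HasEDerivAt (fun t : ℝ => F t) F' x :=
  fun i j => (h i j).comp_ofReal

/-- A matrix function with vanishing derivative is constant. -/
theorem HasEDerivAt.eq_of_zero {𝕜 : Type*} [RCLike 𝕜] [NormedAlgebra 𝕜 ℂ]
    {F : 𝕜 → Matrix ι κ ℂ} (h : ∀ z, HasEDerivAt F 0 z) (z w : 𝕜) : F z = F w := by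
  ext i j
  exact is_const_of_deriv_eq_zero (fun z => (h z i j).differentiableAt)
    (fun z => (h z i j).deriv) z w

end EntrywiseDerivative

section Continuation

variable {N : ℕ}

theorem evalM_eq_sum_range {G : (CMat N)[X]} {m : ℕ} (hG : G.natDegree ≤ m) (z : ℂ) :
    evalM G z = ∑ j ∈ Finset.range (m + 1), z ^ j • G.coeff j :=
  Polynomial.sum_over_range' _ (by simp) _ (by omega)

open Matrix in
attribute [local instance] Matrix.normedAddCommGroup Matrix.normedSpace in
/-- The linear matrix equation `X' = ∑ z ^ j L_j(X)` has an entire solution. -/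
theorem exists_entire_matrix_solution (L : ℕ → CMat N →ₗ[ℂ] CMat N) {m : ℕ}
    (hL : ∀ j, m < j → L j = 0) (X₀ : CMat N) :
    ∃ X : ℂ → CMat N, X 0 = X₀ ∧
      ∀ z, HasEDerivAt X (∑ j ∈ Finset.range (m + 1), z ^ j • L j (X z)) z := by
  have : CompleteSpace (CMat N) := FiniteDimensional.complete ℂ _
  obtain ⟨x, h0, hx⟩ := exists_entire_solution (fun j => LinearMap.toContinuousLinearMap (L j))
    (m := m) (fun j hj => by simp [hL j hj]) X₀
  refine ⟨x, h0, fun z i j => ?_⟩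
  have h1 := hasDerivAt_pi.1 (hasDerivAt_pi.1 (hx z) i) j
  exact h1

/-- Fundamental solutions of `Φ' = G Φ` and `Ψ' = -Ψ G`, inverse to each other. -/
theorem exists_fundamental_solution (G : (CMat N)[X]) :
    ∃ Φ Ψ : ℂ → CMat N, Φ 0 = 1 ∧ Ψ 0 = 1 ∧
      (∀ z, HasEDerivAt Φ (evalM G z * Φ z) z) ∧
      (∀ z, HasEDerivAt Ψ (-(Ψ z * evalM G z)) z) ∧ ∀ z, Ψ z * Φ z = 1 := by
  obtain ⟨Φ, hΦ0, hΦ⟩ := exists_entire_matrix_solution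
    (fun j => LinearMap.mulLeft ℂ (G.coeff j)) (m := G.natDegree)
    (fun j hj => by ext; simp [coeff_eq_zero_of_natDegree_lt hj]) (1 : CMat N)
  obtain ⟨Ψ, hΨ0, hΨ⟩ := exists_entire_matrix_solution
    (fun j => -LinearMap.mulRight ℂ (G.coeff j)) (m := G.natDegree)
    (fun j hj => by ext; simp [coeff_eq_zero_of_natDegree_lt hj]) (1 : CMat N)
  have hΦ' : ∀ z, HasEDerivAt Φ (evalM G z * Φ z) z := by
    intro z
    convert hΦ z using 1
    simp [evalM_eq_sum_range le_rfl, Finset.sum_mul]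
  have hΨ' : ∀ z, HasEDerivAt Ψ (-(Ψ z * evalM G z)) z := by
    intro z
    convert hΨ z using 1
    simp [evalM_eq_sum_range le_rfl, Finset.mul_sum]
  refine ⟨Φ, Ψ, hΦ0, hΨ0, hΦ', hΨ', fun z => ?_⟩
  -- `(Ψ Φ)' = -Ψ G Φ + Ψ G Φ = 0`; invertibility comes from this conserved product, without a
  -- uniqueness theorem for the equation.
  have hc : ∀ z, HasEDerivAt (fun w => Ψ w * Φ w) 0 z := by
    intro z
    convert (hΨ' z).mul (hΦ' z) using 1
    simp [Matrix.mul_assoc]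
  rw [HasEDerivAt.eq_of_zero hc z 0, hΨ0, hΦ0, one_mul]

/-- A solution on the real line of `T' = G T`, invertible at `0`, continues to an entire function
with entire inverse. -/
theorem exists_entire_continuation {G : (CMat N)[X]} {T : ℝ → CMat N}
    (hT : ∀ x : ℝ, HasEDerivAt T (evalM G x * T x) x) (h0 : IsUnit (T 0)) :
    ∃ Tc Ti : ℂ → CMat N, (∀ x : ℝ, Tc x = T x) ∧
      (∀ z, HasEDerivAt Tc (evalM G z * Tc z) z) ∧
      (∀ z, HasEDerivAt Ti (-(Ti z * evalM G z)) z) ∧ ∀ z, Ti z * Tc z = 1 := by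
  obtain ⟨Φ, Ψ, hΦ0, hΨ0, hΦ, hΨ, hinv⟩ := exists_fundamental_solution G
  -- The same cancellation makes `Ψ T` constant on the real line, so `T = Φ T(0)` there and the
  -- right-hand side is the continuation.
  have hc : ∀ x : ℝ, HasEDerivAt (fun t : ℝ => Ψ t * T t) 0 x := by
    intro x
    convert (hΨ x).comp_ofReal.mul (hT x) using 1
    simp [Matrix.mul_assoc]
  have hTe : ∀ x : ℝ, Ψ x * T x = T 0 := by
    intro x
    rw [HasEDerivAt.eq_of_zero hc x 0]
    simp [hΨ0]
  have hdet := (Matrix.isUnit_iff_isUnit_det _).1 h0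
  refine ⟨fun z => Φ z * T 0, fun z => (T 0)⁻¹ * Ψ z, fun x => ?_, fun z => ?_, fun z => ?_,
    fun z => ?_⟩
  · change Φ x * T 0 = T x
    rw [← hTe x, ← mul_assoc, mul_eq_one_comm.1 (hinv x), one_mul]
  · convert (hΦ z).mul (HasEDerivAt.const (T 0) z) using 1
    simp [Matrix.mul_assoc]
  · convert (HasEDerivAt.const (T 0)⁻¹ z).mul (hΨ z) using 1
    simp [Matrix.mul_assoc]
  · rw [mul_assoc, ← mul_assoc (Ψ z), hinv, one_mul, Matrix.nonsing_inv_mul _ hdet]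

end Continuation

/-! ### The star operation and matrix polynomials as functions. -/

section StarFun

variable {N : ℕ}

theorem starFun_add (F H : ℂ → CMat N) : starFun (fun z => F z + H z) = fun z => starFun F z + starFun H z := by
  funext z; simp [starFun]

theorem starFun_neg (F : ℂ → CMat N) : starFun (fun z => -F z) = fun z => -starFun F z := by
  funext z; simp [starFun]

theorem starFun_mul (F H : ℂ → CMat N) :
    starFun (fun z => F z * H z) = fun z => starFun H z * starFun F z := by
  funext z; simp [starFun]

theorem starFun_smul_real (c : ℝ) (F : ℂ → CMat N) :
    starFun (fun z => c • F z) = fun z => c • starFun F z := by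
  funext z; simp [starFun]

theorem starFun_starFun (F : ℂ → CMat N) : starFun (starFun F) = F := by
  funext z; simp [starFun]

end StarFun

section MatPoly

variable {N : ℕ}

/-- `f` is a matrix polynomial of degree less than `d`. -/
def IsMatPoly (d : ℕ) (f : ℂ → CMat N) : Prop :=
  ∃ c : ℕ → CMat N, ∀ z, f z = ∑ i ∈ Finset.range d, z ^ i • c i

theorem IsMatPoly.mono {d e : ℕ} (h : d ≤ e) {f : ℂ → CMat N} (hf : IsMatPoly d f) :
    IsMatPoly e f := by
  obtain ⟨c, hc⟩ := hf
  refine ⟨fun i => if i < d then c i else 0, fun z => ?_⟩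
  rw [hc]
  refine Finset.sum_subset_zero_on_sdiff (fun i hi => ?_) (fun i hi => ?_) fun i hi => ?_
  · simp at hi ⊢; omega
  · simp at hi; simp; omega
  · simp at hi; simp [hi]

theorem IsMatPoly.add {d : ℕ} {f g : ℂ → CMat N} (hf : IsMatPoly d f) (hg : IsMatPoly d g) :
    IsMatPoly d fun z => f z + g z := by
  obtain ⟨a, ha⟩ := hf
  obtain ⟨b, hb⟩ := hg
  exact ⟨fun i => a i + b i, fun z => by simp [ha, hb, Finset.sum_add_distrib]⟩

theorem IsMatPoly.mul_left {d : ℕ} {f : ℂ → CMat N} (hf : IsMatPoly d f) (A : CMat N) :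
    IsMatPoly d fun z => A * f z := by
  obtain ⟨a, ha⟩ := hf
  exact ⟨fun i => A * a i, fun z => by simp [ha, Finset.mul_sum]⟩

theorem IsMatPoly.mul_right {d : ℕ} {f : ℂ → CMat N} (hf : IsMatPoly d f) (A : CMat N) :
    IsMatPoly d fun z => f z * A := by
  obtain ⟨a, ha⟩ := hf
  exact ⟨fun i => a i * A, fun z => by simp [ha, Finset.sum_mul]⟩

theorem IsMatPoly.smul {d : ℕ} {f : ℂ → CMat N} (hf : IsMatPoly d f) (c : ℂ) :
    IsMatPoly d fun z => c • f z := by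
  obtain ⟨a, ha⟩ := hf
  exact ⟨fun i => c • a i, fun z => by simp [ha, Finset.smul_sum, smul_comm c]⟩

theorem IsMatPoly.neg {d : ℕ} {f : ℂ → CMat N} (hf : IsMatPoly d f) :
    IsMatPoly d fun z => -f z := by
  simpa using hf.smul (-1)

theorem IsMatPoly.zero (d : ℕ) : IsMatPoly d fun _ => (0 : CMat N) :=
  ⟨fun _ => 0, fun z => by simp⟩

theorem IsMatPoly.sum {ι : Type*} {d : ℕ} {s : Finset ι} {f : ι → ℂ → CMat N}
    (hf : ∀ i ∈ s, IsMatPoly d (f i)) : IsMatPoly d fun z => ∑ i ∈ s, f i z := by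
  classical
  induction s using Finset.induction_on with
  | empty => simpa using IsMatPoly.zero d
  | insert i s hi ih =>
    simp only [Finset.sum_insert hi]
    exact (hf i (by simp)).add (ih fun j hj => hf j (by simp [hj]))

theorem IsMatPoly.star {d : ℕ} {f : ℂ → CMat N} (hf : IsMatPoly d f) :
    IsMatPoly d (starFun f) := by
  obtain ⟨a, ha⟩ := hf
  exact ⟨fun i => (a i).conjTranspose, fun z => by
    simp [starFun, ha, Matrix.conjTranspose_sum, Matrix.conjTranspose_smul]⟩

theorem IsMatPoly.differentiable {d : ℕ} {f : ℂ → CMat N} (hf : IsMatPoly d f) (i j : Fin N) :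
    Differentiable ℂ fun z => f z i j := by
  obtain ⟨a, ha⟩ := hf
  simp only [ha, Matrix.sum_apply, Matrix.smul_apply, smul_eq_mul]
  fun_prop

theorem evalM_add (G₁ G₂ : (CMat N)[X]) (z : ℂ) :
    evalM (G₁ + G₂) z = evalM G₁ z + evalM G₂ z :=
  sum_add_index _ _ _ (by simp) (by simp [smul_add])

theorem evalM_zero (z : ℂ) : evalM (0 : (CMat N)[X]) z = 0 := sum_zero_index _

theorem evalM_monomial (k : ℕ) (A : CMat N) (z : ℂ) : evalM (monomial k A) z = z ^ k • A :=
  sum_monomial_index _ _ (by simp)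

theorem evalM_sum {ι : Type*} (s : Finset ι) (Q : ι → (CMat N)[X]) (z : ℂ) :
    evalM (∑ i ∈ s, Q i) z = ∑ i ∈ s, evalM (Q i) z :=
  map_sum (AddMonoidHom.mk' (fun Q : (CMat N)[X] => evalM Q z) fun a b => evalM_add a b z) Q s

theorem IsMatPoly.exists_polynomial {d : ℕ} {f : ℂ → CMat N} (hf : IsMatPoly d f) :
    ∃ Q : (CMat N)[X], Q.degree < d ∧ ∀ z, f z = evalM Q z := by
  obtain ⟨a, ha⟩ := hf
  refine ⟨∑ i ∈ Finset.range d, monomial i (a i), ?_, fun z => ?_⟩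
  · rw [← mem_degreeLT]
    refine Submodule.sum_mem _ fun i hi => mem_degreeLT.2 ?_
    refine (degree_monomial_le _ _).trans_lt ?_
    exact_mod_cast Finset.mem_range.1 hi
  · simp_rw [ha, evalM_sum, evalM_monomial]

theorem isMatPoly_evalM {d : ℕ} {G : (CMat N)[X]} (hG : G.natDegree < d) :
    IsMatPoly d (evalM G) :=
  ⟨G.coeff, fun _ => sum_over_range' _ (by simp) _ hG⟩

end MatPoly

/-! ### Degrees of `A_n` and `B_n`, independence of `m`, linearity in `G`. -/

section Coefficients

variable {N : ℕ} (W : ℝ → CMat N) (P : ℕ → (CMat N)[X]) (κ : ℕ → CMat N)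

theorem isMatPoly_PTrunc (n k : ℕ) : IsMatPoly (k + 1) (PTrunc P n k) := by
  refine ⟨fun i => aCoeff P n ((n : ℤ) - (k - i : ℕ)), fun z => ?_⟩
  rw [PTrunc, ← Finset.sum_range_reflect]
  refine Finset.sum_congr rfl fun i hi => ?_
  rw [Finset.mem_range] at hi
  congr 2
  omega

theorem isMatPoly_DeltaM (m : ℕ) (G : (CMat N)[X]) (j n : ℕ) :
    IsMatPoly (j + 1) (DeltaM P m G j n) :=
  IsMatPoly.sum fun k hk => ((isMatPoly_PTrunc P n k).mono
    (by simpa using hk)).mul_right _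

theorem isMatPoly_calA (m : ℕ) (G : (CMat N)[X]) (n : ℕ) : IsMatPoly m (calA W P κ m G n) := by
  refine (IsMatPoly.mul_left (IsMatPoly.sum fun j hj => ?_) _).neg
  have h := (isMatPoly_DeltaM P m G j n).mono (Finset.mem_range.1 hj)
  exact (h.star.mul_left _).add (h.mul_right _)

theorem isMatPoly_calB (m : ℕ) {G : (CMat N)[X]} (hG : G.natDegree ≤ m) :
    ∀ n, IsMatPoly (m + 1) (calB W P κ m G n)
  | 0 => (isMatPoly_evalM (Nat.lt_succ_of_le hG)).neg
  | n + 1 => by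
    refine (IsMatPoly.mul_right (IsMatPoly.sum fun j hj => ?_) _).neg
    have h := fun n => (isMatPoly_DeltaM P m G j n).mono (Finset.mem_range.1 hj)
    exact ((h (n + 1)).mul_right _).add ((h n).star.mul_left _)

theorem isMatPoly_lowerLeft (m : ℕ) (G : (CMat N)[X]) :
    ∀ n, IsMatPoly m (lowerLeft W P κ m G n)
  | 0 => IsMatPoly.zero m
  | n + 1 => ((isMatPoly_calA W P κ m G n).mul_right _).smul _

/-- Passing from `m` to `m + 1` shifts `j` by one and leaves `m - j`, hence the index of `b`,
unchanged. The extra term `j = 0` contains only `M_{m+1} = 0`. -/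
theorem DeltaM_zero_of_natDegree_le {m : ℕ} {G : (CMat N)[X]} (hG : G.natDegree ≤ m) (n : ℕ) :
    DeltaM P (m + 1) G 0 n = fun _ => 0 := by
  funext z
  simp [DeltaM, coeff_eq_zero_of_natDegree_lt (Nat.lt_succ_of_le hG)]

theorem DeltaM_succ_succ {m : ℕ} {G : (CMat N)[X]} (hG : G.natDegree ≤ m) {j : ℕ} (hj : j ≤ m)
    (n : ℕ) : DeltaM P (m + 1) G (j + 1) n = DeltaM P m G j n := by
  funext z
  rw [DeltaM, Finset.sum_range_succ, coeff_eq_zero_of_natDegree_lt (by omega), mul_zero, add_zero,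
    Nat.add_sub_add_right]
  rfl

theorem starFun_zero : starFun (fun _ => (0 : CMat N)) = fun _ => 0 := by
  funext z; simp [starFun]

theorem calA_succ {m : ℕ} {G : (CMat N)[X]} (hG : G.natDegree ≤ m) (n : ℕ) :
    calA W P κ (m + 1) G n = calA W P κ m G n := by
  funext z
  rw [calA, Finset.sum_range_succ', DeltaM_zero_of_natDegree_le P hG, starFun_zero, mul_zero,
    zero_mul, add_zero, add_zero, calA]
  congr 2
  refine Finset.sum_congr rfl fun j hj => ?_
  rw [DeltaM_succ_succ P hG (Finset.mem_range.1 hj).le,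
    show (n : ℤ) + (m + 1 : ℕ) - (j + 1 : ℕ) - 1 = n + m - j - 1 by push_cast; ring]

theorem calB_succ {m : ℕ} {G : (CMat N)[X]} (hG : G.natDegree ≤ m) (n : ℕ) :
    calB W P κ (m + 1) G n = calB W P κ m G n := by
  funext z
  rcases n with _ | n
  · rfl
  rw [calB, Finset.sum_range_succ', DeltaM_zero_of_natDegree_le P hG,
    DeltaM_zero_of_natDegree_le P hG, starFun_zero, mul_zero, zero_mul, add_zero, add_zero, calB]
  congr 2
  refine Finset.sum_congr rfl fun j hj => ?_
  have hj' := Nat.lt_succ_iff.1 (Finset.mem_range.1 hj)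
  rw [DeltaM_succ_succ P hG hj', DeltaM_succ_succ P hG hj',
    show ((n + 1 : ℕ) : ℤ) + (m + 1 : ℕ) - (j + 1 : ℕ) - 1 = (n + 1 : ℕ) + m - j - 1 by
      push_cast; ring,
    show ((n + 1 : ℕ) : ℤ) + (m + 1 : ℕ) - (j + 1 : ℕ) - 2 = (n + 1 : ℕ) + m - j - 2 by
      push_cast; ring]

theorem FMat_succ {m : ℕ} {G : (CMat N)[X]} (hG : G.natDegree ≤ m) (n : ℕ) (z : ℂ) :
    FMat W P κ (m + 1) G n z = FMat W P κ m G n z := by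
  have hl : lowerLeft W P κ (m + 1) G n = lowerLeft W P κ m G n := by
    rcases n with _ | n
    · rfl
    · funext z; rw [lowerLeft, lowerLeft, calA_succ W P κ hG]
  rw [FMat, FMat, calA_succ W P κ hG, calB_succ W P κ hG, hl]

theorem FMat_eq_of_natDegree_le {m : ℕ} {G : (CMat N)[X]} (hG : G.natDegree ≤ m) (n : ℕ) (z : ℂ) :
    FMat W P κ m G n z = FMat W P κ G.natDegree G n z := by
  induction m, hG using Nat.le_induction with
  | base => rfl
  | succ m hm ih => rw [FMat_succ W P κ hm, ih]

theorem DeltaM_add (m : ℕ) (G₁ G₂ : (CMat N)[X]) (j n : ℕ) :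
    DeltaM P m (G₁ + G₂) j n = fun z => DeltaM P m G₁ j n z + DeltaM P m G₂ j n z := by
  funext z
  simp [DeltaM, mul_add, Finset.sum_add_distrib]

theorem DeltaM_smul (m : ℕ) (c : ℝ) (G : (CMat N)[X]) (j n : ℕ) :
    DeltaM P m (c • G) j n = fun z => c • DeltaM P m G j n z := by
  funext z
  simp [DeltaM, Finset.smul_sum]

theorem evalM_smul (c : ℝ) (G : (CMat N)[X]) (z : ℂ) : evalM (c • G) z = c • evalM G z := by
  rw [evalM_eq_sum_range (natDegree_smul_le c G), evalM_eq_sum_range le_rfl, Finset.smul_sum]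
  refine Finset.sum_congr rfl fun i _ => ?_
  rw [coeff_smul, smul_comm]

theorem calA_add (m : ℕ) (G₁ G₂ : (CMat N)[X]) (n : ℕ) :
    calA W P κ m (G₁ + G₂) n = fun z => calA W P κ m G₁ n z + calA W P κ m G₂ n z := by
  funext z
  simp only [calA, DeltaM_add, starFun_add, mul_add, add_mul, Finset.sum_add_distrib]
  abel

theorem calA_smul (m : ℕ) (c : ℝ) (G : (CMat N)[X]) (n : ℕ) :
    calA W P κ m (c • G) n = fun z => c • calA W P κ m G n z := by
  funext z
  simp only [calA, DeltaM_smul, starFun_smul_real, mul_smul_comm, smul_mul_assoc, ← smul_add,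
    ← Finset.smul_sum, smul_neg]

theorem calB_add (m : ℕ) (G₁ G₂ : (CMat N)[X]) (n : ℕ) :
    calB W P κ m (G₁ + G₂) n = fun z => calB W P κ m G₁ n z + calB W P κ m G₂ n z := by
  funext z
  rcases n with _ | n
  · simp only [calB, evalM_add]; abel
  · simp only [calB, DeltaM_add, starFun_add, mul_add, add_mul, Finset.sum_add_distrib]
    abel

theorem calB_smul (m : ℕ) (c : ℝ) (G : (CMat N)[X]) (n : ℕ) :
    calB W P κ m (c • G) n = fun z => c • calB W P κ m G n z := by
  funext z
  rcases n with _ | n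
  · simp only [calB, evalM_smul, smul_neg]
  · simp only [calB, DeltaM_smul, starFun_smul_real, mul_smul_comm, smul_mul_assoc, ← smul_add,
      ← Finset.smul_sum, smul_neg]

theorem FMat_add (m : ℕ) (G₁ G₂ : (CMat N)[X]) (n : ℕ) (z : ℂ) :
    FMat W P κ m (G₁ + G₂) n z = FMat W P κ m G₁ n z + FMat W P κ m G₂ n z := by
  have hl : lowerLeft W P κ m (G₁ + G₂) n z
      = lowerLeft W P κ m G₁ n z + lowerLeft W P κ m G₂ n z := by
    rcases n with _ | n
    · simp [lowerLeft]
    · simp only [lowerLeft, calA_add, add_mul, smul_add]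
  simp only [FMat, hl, calA_add, calB_add, starFun_add, Matrix.fromBlocks_add, mul_add, smul_add,
    neg_add]

/-- Real scalars only: the formulas mix `Δ` with `Δ^*`, so a complex scalar would appear conjugated
in some of the terms. -/
theorem FMat_smul (m : ℕ) (c : ℝ) (G : (CMat N)[X]) (n : ℕ) (z : ℂ) :
    FMat W P κ m (c • G) n z = c • FMat W P κ m G n z := by
  have hl : lowerLeft W P κ m (c • G) n z = c • lowerLeft W P κ m G n z := by
    rcases n with _ | n
    · simp [lowerLeft]
    · simp only [lowerLeft, calA_smul, smul_mul_assoc, smul_comm c]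
  simp only [FMat, hl, calA_smul, calB_smul, starFun_smul_real, Matrix.fromBlocks_smul,
    mul_smul_comm, smul_neg, smul_comm c]

end Coefficients

/-! ### Moments, orthogonality and uniqueness of the orthogonal polynomials. -/

section EntrywiseIntegral

variable {N : ℕ}

/-- All entries of `F` are integrable over the real line. -/
def IntegrableM (F : ℝ → CMat N) : Prop :=
  ∀ i j, Integrable fun x => F x i j

theorem IntegrableM.sum {ι : Type*} {s : Finset ι} {F : ι → ℝ → CMat N}
    (h : ∀ i ∈ s, IntegrableM (F i)) : IntegrableM fun x => ∑ i ∈ s, F i x := by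
  intro a b
  simp only [Matrix.sum_apply]
  exact integrable_finsetSum _ fun i hi => h i hi a b

theorem IntegrableM.mul_left {F : ℝ → CMat N} (h : IntegrableM F) (A : CMat N) :
    IntegrableM fun x => A * F x := by
  intro a b
  simp only [Matrix.mul_apply]
  exact integrable_finsetSum _ fun i _ => (h i b).const_mul _

theorem IntegrableM.mul_right {F : ℝ → CMat N} (h : IntegrableM F) (A : CMat N) :
    IntegrableM fun x => F x * A := by
  intro a b
  simp only [Matrix.mul_apply]
  exact integrable_finsetSum _ fun i _ => (h a i).mul_const _

theorem intM_sum {ι : Type*} {s : Finset ι} {F : ι → ℝ → CMat N}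
    (h : ∀ i ∈ s, IntegrableM (F i)) :
    intM (fun x => ∑ i ∈ s, F i x) = ∑ i ∈ s, intM (F i) := by
  ext a b
  simp only [intM, Matrix.of_apply, Matrix.sum_apply]
  exact integral_finsetSum _ fun i hi => h i hi a b

theorem intM_mul_left {F : ℝ → CMat N} (h : IntegrableM F) (A : CMat N) :
    intM (fun x => A * F x) = A * intM F := by
  ext a b
  simp only [intM, Matrix.of_apply, Matrix.mul_apply]
  rw [integral_finsetSum _ fun i _ => (h i b).const_mul _]
  simp [integral_const_mul]

theorem intM_mul_right {F : ℝ → CMat N} (h : IntegrableM F) (A : CMat N) :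
    intM (fun x => F x * A) = intM F * A := by
  ext a b
  simp only [intM, Matrix.of_apply, Matrix.mul_apply]
  rw [integral_finsetSum _ fun i _ => (h a i).mul_const _]
  simp [integral_mul_const]

theorem intM_conjTranspose (F : ℝ → CMat N) :
    intM (fun x => (F x).conjTranspose) = (intM F).conjTranspose := by
  ext a b
  simp only [intM, Matrix.of_apply, Matrix.conjTranspose_apply]
  exact integral_conj

end EntrywiseIntegral

section Orthogonality

variable {N : ℕ} {W : ℝ → CMat N}

/-- `∫ x ^ k Q(x) W(x) dx`. -/
noncomputable def momW (W : ℝ → CMat N) (Q : (CMat N)[X]) (k : ℕ) : CMat N :=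
  intM fun x => (x : ℂ) ^ k • (evalM Q x * W x)

theorem evalM_C_mul (A : CMat N) (Q : (CMat N)[X]) (z : ℂ) :
    evalM (C A * Q) z = A * evalM Q z := by
  rw [evalM_eq_sum_range (natDegree_C_mul_le A Q), evalM_eq_sum_range le_rfl, Finset.mul_sum]
  simp

theorem IsWeight.integrableM (hW : IsWeight W) (Q : (CMat N)[X]) (k : ℕ) :
    IntegrableM fun x : ℝ => (x : ℂ) ^ k • (evalM Q x * W x) := by
  have h : ∀ x : ℝ, (x : ℂ) ^ k • (evalM Q x * W x) =
      ∑ i ∈ Finset.range (Q.natDegree + 1), Q.coeff i * ((x : ℂ) ^ (k + i) • W x) := by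
    intro x
    rw [evalM_eq_sum_range le_rfl, Finset.sum_mul, Finset.smul_sum]
    refine Finset.sum_congr rfl fun i _ => ?_
    rw [smul_mul_assoc, smul_smul, pow_add, mul_smul_comm]
  simp only [h]
  refine IntegrableM.sum fun i _ => IntegrableM.mul_left (fun a b => ?_) _
  simpa using hW.moments (k + i) a b

theorem momW_add (hW : IsWeight W) (Q₁ Q₂ : (CMat N)[X]) (k : ℕ) :
    momW W (Q₁ + Q₂) k = momW W Q₁ k + momW W Q₂ k := by
  ext a b
  simp only [momW, intM, Matrix.of_apply, Matrix.add_apply]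
  rw [← integral_add (hW.integrableM Q₁ k a b) (hW.integrableM Q₂ k a b)]
  simp [evalM_add, add_mul, mul_add]

theorem momW_C_mul (hW : IsWeight W) (A : CMat N) (Q : (CMat N)[X]) (k : ℕ) :
    momW W (C A * Q) k = A * momW W Q k := by
  rw [momW, momW, ← intM_mul_left (hW.integrableM Q k)]
  simp only [evalM_C_mul, mul_smul_comm, mul_assoc]

theorem innerW_eq_sum (hW : IsWeight W) (Q R : (CMat N)[X]) {d : ℕ} (hR : R.natDegree ≤ d) :
    innerW W Q R = ∑ j ∈ Finset.range (d + 1), momW W Q j * (R.coeff j).conjTranspose := by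
  simp only [momW, ← intM_mul_right (hW.integrableM Q _)]
  rw [← intM_sum fun j _ => (hW.integrableM Q j).mul_right _, innerW]
  congr 1
  funext x
  rw [evalM_eq_sum_range hR, Matrix.conjTranspose_sum, Finset.mul_sum]
  refine Finset.sum_congr rfl fun j _ => ?_
  simp [Matrix.conjTranspose_smul]

theorem innerW_conjTranspose (hW : IsWeight W) (Q R : (CMat N)[X]) :
    (innerW W Q R).conjTranspose = innerW W R Q := by
  rw [innerW, ← intM_conjTranspose, innerW]
  simp only [Matrix.conjTranspose_mul, Matrix.conjTranspose_conjTranspose,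
    (hW.posDef _).isHermitian.eq, Matrix.mul_assoc]

theorem innerW_add_right (hW : IsWeight W) (Q R S : (CMat N)[X]) :
    innerW W Q (R + S) = innerW W Q R + innerW W Q S := by
  rw [innerW_eq_sum hW Q (R + S) (d := max R.natDegree S.natDegree) (natDegree_add_le _ _),
    innerW_eq_sum hW Q R (le_max_left _ S.natDegree),
    innerW_eq_sum hW Q S (le_max_right R.natDegree _), ← Finset.sum_add_distrib]
  simp [mul_add]

theorem innerW_C_mul_right (hW : IsWeight W) (A : CMat N) (Q R : (CMat N)[X]) :
    innerW W Q (C A * R) = innerW W Q R * A.conjTranspose := by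
  rw [innerW_eq_sum hW Q _ (natDegree_C_mul_le A R), innerW_eq_sum hW Q R le_rfl, Finset.sum_mul]
  simp [mul_assoc]

variable {P : ℕ → (CMat N)[X]} {κ : ℕ → CMat N}

theorem IsMOPRL.natDegree_le (hP : IsMOPRL W P κ) (n : ℕ) : (P n).natDegree ≤ n :=
  natDegree_le_iff_degree_le.2 (hP.degree_le n)

theorem IsMOPRL.momW_eq_zero (hW : IsWeight W) (hP : IsMOPRL W P κ) {n k : ℕ} (hk : k < n) :
    momW W (P n) k = 0 := by
  have h := hP.orthogonal n (monomial k 1)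
    ((degree_monomial_le _ _).trans_lt (by exact_mod_cast hk))
  rw [innerW_eq_sum hW (P n) _ (natDegree_monomial_le (m := k) 1), Finset.sum_eq_single k] at h
  · simpa using h
  · intro j _ hj
    simp [coeff_monomial, hj.symm]
  · simp

theorem IsMOPRL.innerW_self (hW : IsWeight W) (hP : IsMOPRL W P κ) (n : ℕ) :
    innerW W (P n) (P n) = momW W (P n) n := by
  rw [innerW_eq_sum hW (P n) _ (hP.natDegree_le n), Finset.sum_range_succ, Finset.sum_eq_zero,
    hP.monic]
  · simp
  · intro j hj
    rw [hP.momW_eq_zero hW (Finset.mem_range.1 hj), zero_mul]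

/-- With `h = ∫ x^n P_n W`, orthonormality reads `κ h κ^* = 1`; for square matrices the factors can
be rotated to `h κ^* κ = 1`. -/
theorem IsMOPRL.momW_self_mul_gammaM (hW : IsWeight W) (hP : IsMOPRL W P κ) (n : ℕ) :
    momW W (P n) n * gammaM κ n = 1 := by
  have h := hP.orthonormal n n
  rw [if_pos rfl, innerW_C_mul_right hW, ← innerW_conjTranspose hW, innerW_C_mul_right hW,
    Matrix.conjTranspose_mul, Matrix.conjTranspose_conjTranspose, innerW_conjTranspose hW,
    hP.innerW_self hW, mul_eq_one_comm, ← mul_assoc] at h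
  exact mul_eq_one_comm.1 h

theorem IsMOPRL.gammaM_inv (hW : IsWeight W) (hP : IsMOPRL W P κ) (n : ℕ) :
    (gammaM κ n)⁻¹ = momW W (P n) n :=
  Matrix.inv_eq_left_inv (hP.momW_self_mul_gammaM hW n)

/-- A matrix polynomial of degree less than `n` orthogonal to `1, …, x ^ (n - 1)` vanishes. -/
theorem IsMOPRL.eq_zero_of_momW (hW : IsWeight W) (hP : IsMOPRL W P κ) {n : ℕ} {D : (CMat N)[X]}
    (hD : D.degree < n) (h : ∀ k < n, momW W D k = 0) : D = 0 := by
  by_contra hne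
  have hd : D.natDegree < n := (natDegree_lt_iff_degree_lt hne).2 hD
  set d := D.natDegree with hdd
  have h1 : innerW W (P d) D = 0 := by
    rw [← innerW_conjTranspose hW, innerW_eq_sum hW D _ (hP.natDegree_le d), Finset.sum_eq_zero]
    · simp
    · intro j hj
      rw [h j ((Nat.lt_succ_iff.1 (Finset.mem_range.1 hj)).trans_lt hd), zero_mul]
  -- The remainder has degree below `d` and is orthogonal to `P d`, so the pairing of `P d` with `D`
  -- is `h_d` times the starred leading coefficient, with `h_d` invertible.
  have h2 : D = C D.leadingCoeff * P d + (D - C D.leadingCoeff * P d) := by abel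
  have h3 : (D - C D.leadingCoeff * P d).degree < d := by
    rw [degree_lt_iff_coeff_zero]
    intro k hk
    rw [coeff_sub, coeff_C_mul]
    rcases hk.eq_or_lt with rfl | hk
    · rw [hP.monic, mul_one, leadingCoeff, ← hdd, sub_self]
    · rw [coeff_eq_zero_of_natDegree_lt hk,
        coeff_eq_zero_of_natDegree_lt ((hP.natDegree_le d).trans_lt hk), mul_zero, sub_zero]
  rw [h2, innerW_add_right hW, innerW_C_mul_right hW, hP.orthogonal d _ h3, add_zero,
    hP.innerW_self hW] at h1
  have h4 := hP.momW_self_mul_gammaM hW d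
  rw [mul_eq_one_comm] at h4
  have h5 : D.leadingCoeff.conjTranspose = 0 := by
    rw [← one_mul D.leadingCoeff.conjTranspose, ← h4, mul_assoc, h1, mul_zero]
  exact hne (leadingCoeff_eq_zero.1 (Matrix.conjTranspose_eq_zero.1 h5))

/-- A monic matrix polynomial of degree `n` orthogonal to `1, …, x ^ (n - 1)` is `P n`. -/
theorem IsMOPRL.eq_of_monic (hW : IsWeight W) (hP : IsMOPRL W P κ) {n : ℕ} {Q : (CMat N)[X]}
    (hQ : Q.natDegree ≤ n) (hm : Q.coeff n = 1) (h : ∀ k < n, momW W Q k = 0) : Q = P n := by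
  have h1 : Q + C (-1) * P n = 0 := by
    refine hP.eq_zero_of_momW hW (n := n) ?_ fun k hk => ?_
    · rw [degree_lt_iff_coeff_zero]
      intro k hk
      rw [coeff_add, coeff_C_mul]
      rcases hk.eq_or_lt with rfl | hk
      · rw [hP.monic, hm]; simp
      · rw [coeff_eq_zero_of_natDegree_lt (hQ.trans_lt hk),
          coeff_eq_zero_of_natDegree_lt ((hP.natDegree_le n).trans_lt hk)]; simp
    · rw [momW_add hW, momW_C_mul hW, h k hk, hP.momW_eq_zero hW hk]; simp
  ext1 k
  have h2 := congrArg (fun p => coeff p k) h1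
  simp only [coeff_add, coeff_C_mul, coeff_zero, neg_mul, one_mul] at h2
  exact add_neg_eq_zero.1 h2

/-- A matrix polynomial of degree at most `n` orthogonal to `1, …, x ^ (n - 1)` is determined by
its product with `x ^ n`. -/
theorem IsMOPRL.eq_C_mul (hW : IsWeight W) (hP : IsMOPRL W P κ) {n : ℕ} {Q : (CMat N)[X]}
    (hQ : Q.natDegree ≤ n) (h : ∀ k < n, momW W Q k = 0) :
    Q = C (momW W Q n * gammaM κ n) * P n := by
  have h4 := hP.momW_self_mul_gammaM hW n
  rw [mul_eq_one_comm] at h4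
  have h1 : Q + C (-(momW W Q n * gammaM κ n)) * P n = 0 := by
    refine hP.eq_zero_of_momW hW (n := n + 1) ?_ fun k hk => ?_
    · rw [degree_lt_iff_coeff_zero]
      intro k hk
      rw [coeff_add, coeff_C_mul, coeff_eq_zero_of_natDegree_lt (by omega),
          coeff_eq_zero_of_natDegree_lt ((hP.natDegree_le n).trans_lt hk)]; simp
    · rw [momW_add hW, momW_C_mul hW]
      rcases (Nat.lt_succ_iff.1 hk).eq_or_lt with rfl | hk
      · rw [neg_mul, mul_assoc, h4]; simp
      · rw [h k hk, hP.momW_eq_zero hW hk]; simp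
  ext1 k
  have h2 := congrArg (fun p => coeff p k) h1
  simp only [coeff_add, coeff_C_mul, coeff_zero, neg_mul] at h2
  rw [coeff_C_mul]
  exact add_neg_eq_zero.1 h2

/-- The convention `b_{n,k} = 0` for `k < n` agrees with the integral, by orthogonality. -/
theorem IsMOPRL.bCoeff_eq (hW : IsWeight W) (hP : IsMOPRL W P κ) (n k : ℕ) :
    bCoeff W P n k = momW W (P n) k := by
  rw [bCoeff]
  split_ifs with h
  · rw [hP.momW_eq_zero hW (by exact_mod_cast h)]
  · simp [momW]

end Orthogonality

/-! ### Entrywise growth at infinity off the real line. -/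

section EntrywiseBigO

variable {ι κ μ : Type*}

/-- All entries of `F` are `O(g)` at infinity off the real line. -/
def EntrywiseBigO (F : ℂ → Matrix ι κ ℂ) (g : ℂ → ℂ) : Prop :=
  ∀ i j, (fun z => F z i j) =O[offReal] g

theorem eventually_offReal_im_ne_zero : ∀ᶠ z in offReal, z.im ≠ 0 :=
  eventually_inf_principal.2 (Eventually.of_forall fun _ h => h)

theorem eventually_offReal_norm_ge (r : ℝ) : ∀ᶠ z in offReal, r ≤ ‖z‖ := by
  refine Filter.Eventually.filter_mono inf_le_left ?_
  exact (tendsto_norm_cocompact_atTop (E := ℂ)).eventually_ge_atTop r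

theorem ne_zero_of_im_ne_zero {z : ℂ} (h : z.im ≠ 0) : z ≠ 0 := by
  rintro rfl; simp at h

theorem isBigO_zpow_mono {a b : ℤ} (h : a ≤ b) :
    (fun z : ℂ => z ^ a) =O[offReal] fun z => z ^ b := by
  refine IsBigO.of_bound 1 ?_
  filter_upwards [eventually_offReal_norm_ge 1] with z hz
  rw [one_mul, norm_zpow, norm_zpow]
  exact zpow_le_zpow_right₀ hz h

theorem isBigO_zpow_neg_one_inv_im :
    (fun z : ℂ => z ^ (-1 : ℤ)) =O[offReal] fun z => ((z.im : ℂ))⁻¹ := by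
  refine IsBigO.of_bound 1 ?_
  filter_upwards [eventually_offReal_im_ne_zero] with z hz
  rw [one_mul, zpow_neg_one, norm_inv, norm_inv, Complex.norm_real, Real.norm_eq_abs]
  exact inv_anti₀ (abs_pos.2 hz) (Complex.abs_im_le_norm z)

theorem tendsto_conj_offReal : Tendsto (starRingEnd ℂ) offReal offReal := by
  refine (Complex.conjLIE.toHomeomorph.isClosedEmbedding.tendsto_cocompact).inf ?_
  rw [tendsto_principal_principal]
  intro z hz
  simpa using hz

theorem EntrywiseBigO.congr' {F H : ℂ → Matrix ι κ ℂ} {g : ℂ → ℂ} (hF : EntrywiseBigO F g)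
    (h : ∀ z : ℂ, z.im ≠ 0 → F z = H z) : EntrywiseBigO H g := by
  intro i j
  refine (hF i j).congr' ?_ EventuallyEq.rfl
  filter_upwards [eventually_offReal_im_ne_zero] with z hz
  rw [h z hz]

theorem EntrywiseBigO.trans {F : ℂ → Matrix ι κ ℂ} {g h : ℂ → ℂ} (hF : EntrywiseBigO F g)
    (hg : g =O[offReal] h) : EntrywiseBigO F h :=
  fun i j => (hF i j).trans hg

theorem EntrywiseBigO.add {F H : ℂ → Matrix ι κ ℂ} {g : ℂ → ℂ} (hF : EntrywiseBigO F g)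
    (hH : EntrywiseBigO H g) : EntrywiseBigO (fun z => F z + H z) g :=
  fun i j => (hF i j).add (hH i j)

theorem EntrywiseBigO.sub {F H : ℂ → Matrix ι κ ℂ} {g : ℂ → ℂ} (hF : EntrywiseBigO F g)
    (hH : EntrywiseBigO H g) : EntrywiseBigO (fun z => F z - H z) g :=
  fun i j => (hF i j).sub (hH i j)

theorem EntrywiseBigO.neg {F : ℂ → Matrix ι κ ℂ} {g : ℂ → ℂ} (hF : EntrywiseBigO F g) :
    EntrywiseBigO (fun z => -F z) g :=
  fun i j => (hF i j).neg_left

theorem EntrywiseBigO.const_smul {F : ℂ → Matrix ι κ ℂ} {g : ℂ → ℂ} (hF : EntrywiseBigO F g)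
    (c : ℂ) : EntrywiseBigO (fun z => c • F z) g :=
  fun i j => (hF i j).const_mul_left c

theorem EntrywiseBigO.sum {α : Type*} {s : Finset α} {F : α → ℂ → Matrix ι κ ℂ} {g : ℂ → ℂ}
    (hF : ∀ a ∈ s, EntrywiseBigO (F a) g) : EntrywiseBigO (fun z => ∑ a ∈ s, F a z) g := by
  intro i j
  simp only [Matrix.sum_apply]
  exact IsBigO.fun_sum fun a ha => hF a ha i j

theorem EntrywiseBigO.mul [Fintype κ] {F : ℂ → Matrix ι κ ℂ} {H : ℂ → Matrix κ μ ℂ} {f g : ℂ → ℂ}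
    (hF : EntrywiseBigO F f) (hH : EntrywiseBigO H g) :
    EntrywiseBigO (fun z => F z * H z) fun z => f z * g z := by
  intro i j
  simp only [Matrix.mul_apply]
  exact IsBigO.fun_sum fun k _ => (hF i k).mul (hH k j)

theorem EntrywiseBigO.mul_zpow [Fintype κ] {F : ℂ → Matrix ι κ ℂ} {H : ℂ → Matrix κ μ ℂ}
    {a b c : ℤ} (hF : EntrywiseBigO F fun z => z ^ a) (hH : EntrywiseBigO H fun z => z ^ b)
    (h : a + b ≤ c) : EntrywiseBigO (fun z => F z * H z) fun z => z ^ c := by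
  refine (hF.mul hH).trans (IsBigO.trans ?_ (isBigO_zpow_mono h))
  refine IsBigO.of_bound 1 ?_
  filter_upwards [eventually_offReal_im_ne_zero] with z hz
  rw [zpow_add₀ (ne_zero_of_im_ne_zero hz), one_mul]

theorem entrywiseBigO_zpow_smul (A : Matrix ι κ ℂ) {a b : ℤ} (h : a ≤ b) :
    EntrywiseBigO (fun z : ℂ => z ^ a • A) fun z => z ^ b := by
  intro i j
  simp only [Matrix.smul_apply, smul_eq_mul, mul_comm]
  exact (isBigO_zpow_mono h).const_mul_left _

theorem entrywiseBigO_const (A : Matrix ι κ ℂ) {b : ℤ} (h : 0 ≤ b) :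
    EntrywiseBigO (fun _ : ℂ => A) fun z => z ^ b := by
  simpa using entrywiseBigO_zpow_smul A h

theorem EntrywiseBigO.zpow_smul {F : ℂ → Matrix ι κ ℂ} {a b c : ℤ}
    (hF : EntrywiseBigO F fun z => z ^ a) (h : b + a ≤ c) :
    EntrywiseBigO (fun z => z ^ b • F z) fun z => z ^ c := by
  intro i j
  refine ((isBigO_refl (fun z : ℂ => z ^ b) offReal).mul (hF i j)).trans
    (IsBigO.trans ?_ (isBigO_zpow_mono h))
  refine IsBigO.of_bound 1 ?_
  filter_upwards [eventually_offReal_im_ne_zero] with z hz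
  rw [zpow_add₀ (ne_zero_of_im_ne_zero hz), one_mul]

theorem IsMatPoly.entrywiseBigO {N d : ℕ} {f : ℂ → CMat N} (hf : IsMatPoly (d + 1) f) :
    EntrywiseBigO f fun z => z ^ (d : ℤ) := by
  obtain ⟨c, hc⟩ := hf
  rw [funext hc]
  refine EntrywiseBigO.sum fun i hi => ?_
  have := Nat.lt_succ_iff.1 (Finset.mem_range.1 hi)
  simpa using entrywiseBigO_zpow_smul (c i) (a := i) (b := d) (by exact_mod_cast this)

theorem isBigO_conj_comp {f : ℂ → ℂ} {k : ℤ} (hf : f =O[offReal] fun z => z ^ k) :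
    (fun z => starRingEnd ℂ (f (starRingEnd ℂ z))) =O[offReal] fun z => z ^ k := by
  have h := hf.comp_tendsto tendsto_conj_offReal
  rw [← isBigO_norm_left]
  simp only [RCLike.norm_conj]
  refine h.norm_left.trans (IsBigO.of_bound 1 (Eventually.of_forall fun z => ?_))
  simp [norm_zpow]

theorem EntrywiseBigO.star {N : ℕ} {F : ℂ → CMat N} {k : ℤ}
    (hF : EntrywiseBigO F fun z => z ^ k) : EntrywiseBigO (starFun F) fun z => z ^ k :=
  fun i j => isBigO_conj_comp (hF j i)

/-- An entire matrix function that is `O(1 / |Im z|)` at infinity vanishes. -/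
theorem EntrywiseBigO.eq_zero {F : ℂ → Matrix ι κ ℂ}
    (hd : ∀ i j, Differentiable ℂ fun z => F z i j)
    (hF : EntrywiseBigO F fun z => ((z.im : ℂ))⁻¹) (z : ℂ) : F z = 0 := by
  ext i j
  exact congrFun (eq_zero_of_isBigO_inv_im (hd i j) (hF i j)) z

/-- Cauchy's estimate off the real line. -/
theorem isBigO_deriv_inv_im {f : ℂ → ℂ} (hf : DifferentiableOn ℂ f {z | z.im ≠ 0})
    (h : f =O[offReal] fun z => z ^ (0 : ℤ)) : deriv f =O[offReal] fun z => ((z.im : ℂ))⁻¹ := by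
  obtain ⟨C, hC⟩ := h.bound
  rw [eventually_inf_principal, ← Metric.cobounded_eq_cocompact, ← comap_norm_atTop,
    eventually_comap, eventually_atTop] at hC
  obtain ⟨R, hR⟩ := hC
  refine IsBigO.of_bound (2 * C) ?_
  -- The disc of radius `|Im z| / 2` avoids the real line, and its points have norm at least `‖z‖ /
  -- 2 ≥ R`, so the bound `C` holds on it.
  filter_upwards [eventually_offReal_im_ne_zero, eventually_offReal_norm_ge (2 * R)] with z hz hzR
  have hpos : 0 < |z.im| := abs_pos.2 hz
  have hsub : ∀ w ∈ Metric.closedBall z (|z.im| / 2), w.im ≠ 0 := by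
    intro w hw h0
    rw [mem_closedBall_iff_norm'] at hw
    have h1 := (Complex.abs_im_le_norm (z - w)).trans hw
    rw [Complex.sub_im, h0, sub_zero] at h1
    linarith
  have hdiff : DiffContOnCl ℂ f (Metric.ball z (|z.im| / 2)) := by
    refine DifferentiableOn.diffContOnCl ?_
    rw [closure_ball _ (by positivity)]
    exact hf.mono fun w hw => hsub w hw
  have key := Complex.norm_deriv_le_of_forall_mem_sphere_norm_le (C := C) (half_pos hpos) hdiff ?_
  · refine key.trans (le_of_eq ?_)
    rw [norm_inv, Complex.norm_real, Real.norm_eq_abs]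
    field_simp
  · intro w hw
    have hw' := Metric.sphere_subset_closedBall hw
    have h1 := hR ‖w‖ ?_ w rfl (hsub w hw')
    · simpa using h1
    · rw [mem_closedBall_iff_norm] at hw'
      have h2 := Complex.abs_im_le_norm z
      have h3 := norm_sub_norm_le z w
      rw [norm_sub_rev] at h3
      linarith

end EntrywiseBigO

/-! ### The flip symmetry, an order-reversing involution on block matrices. -/

section Flip

variable {N : ℕ}

/-- `F ↦ K F^*(z) K`, where `K` swaps the two blocks. -/
def flipFun (F : ℂ → BMat N) (z : ℂ) : BMat N :=
  (F (starRingEnd ℂ z)).conjTranspose.submatrix Sum.swap Sum.swap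

theorem flipFun_mul (F H : ℂ → BMat N) :
    flipFun (fun z => F z * H z) = fun z => flipFun H z * flipFun F z := by
  funext z
  simp only [flipFun, Matrix.conjTranspose_mul]
  exact (Matrix.submatrix_mul_equiv _ _ Sum.swap (Equiv.sumComm _ _) Sum.swap).symm

theorem flipFun_fromBlocks (A B C D : ℂ → CMat N) :
    flipFun (fun z => Matrix.fromBlocks (A z) (B z) (C z) (D z)) =
      fun z => Matrix.fromBlocks (starFun D z) (starFun B z) (starFun C z) (starFun A z) := by
  funext z
  simp only [flipFun, Matrix.fromBlocks_conjTranspose]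
  ext (i | i) (j | j) <;> rfl

theorem EntrywiseBigO.flip {F : ℂ → BMat N} {k : ℤ} (hF : EntrywiseBigO F fun z => z ^ k) :
    EntrywiseBigO (flipFun F) fun z => z ^ k :=
  fun i j => isBigO_conj_comp (hF j.swap i.swap)

theorem differentiable_flipFun {F : ℂ → BMat N} (hF : ∀ i j, Differentiable ℂ fun z => F z i j)
    (i j : Fin N ⊕ Fin N) : Differentiable ℂ fun z => flipFun F z i j := by
  intro z
  have h := (hF j.swap i.swap (starRingEnd ℂ z)).hasDerivAt.conj_conj
  rw [Complex.conj_conj] at h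
  exact h.differentiableAt

theorem HasEDerivAt.starFun {F F' : ℂ → CMat N} {z : ℂ}
    (hF : HasEDerivAt F (F' (starRingEnd ℂ z)) (starRingEnd ℂ z)) :
    HasEDerivAt (starFun F) (starFun F' z) z := by
  intro i j
  have h := (hF j i).conj_conj
  rw [Complex.conj_conj] at h
  exact h

end Flip

/-! ### Polynomial parts at infinity and asymptotic expansions. -/

section PolynomialParts

variable {N : ℕ} (P : ℕ → (CMat N)[X])

/-- The range runs past `i = n`, where `a_{n,n-i} = 0`, so that the sum can be split after `i = k`
even when `k > n`. -/
theorem evalM_eq_sum_aCoeff {n : ℕ} (hP : (P n).natDegree ≤ n) (k : ℕ) (z : ℂ) :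
    evalM (P n) z = ∑ i ∈ Finset.range (k + 1 + n), z ^ ((n : ℤ) - i) • aCoeff P n ((n : ℤ) - i) := by
  rw [show k + 1 + n = (n + 1) + k by omega, Finset.sum_range_add, Finset.sum_eq_zero (s := .range k),
    add_zero, evalM_eq_sum_range hP, ← Finset.sum_range_reflect]
  · refine Finset.sum_congr rfl fun i hi => ?_
    have hi' := Nat.lt_succ_iff.1 (Finset.mem_range.1 hi)
    rw [show n + 1 - 1 - i = n - i by omega, ← Nat.cast_sub hi', aCoeff, if_neg (by omega),
      zpow_natCast, Int.toNat_natCast]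
  · intro i _
    rw [aCoeff, if_pos (by push_cast; omega), smul_zero]

/-- `P_{n,k}` is the polynomial part of `z^{k-n} P_n`: the terms cut off have exponent `k - i ≤ -1`.
-/
theorem zpow_smul_evalM_sub_PTrunc {n : ℕ} (hP : (P n).natDegree ≤ n) (k : ℕ) :
    EntrywiseBigO (fun z => z ^ ((k : ℤ) - n) • evalM (P n) z - PTrunc P n k z)
      fun z => z ^ (-1 : ℤ) := by
  have h : EntrywiseBigO (fun z : ℂ => ∑ i ∈ Finset.range n,
      z ^ ((k : ℤ) - (k + 1 + i : ℕ)) • aCoeff P n ((n : ℤ) - (k + 1 + i : ℕ)))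
      fun z => z ^ (-1 : ℤ) :=
    EntrywiseBigO.sum fun i _ => entrywiseBigO_zpow_smul _ (by push_cast; omega)
  refine h.congr' fun z hz => ?_
  have hz0 := ne_zero_of_im_ne_zero hz
  rw [evalM_eq_sum_aCoeff P hP k z, Finset.smul_sum, Finset.sum_range_add, PTrunc]
  simp only [smul_smul, ← zpow_add₀ hz0]
  rw [eq_sub_iff_add_eq, add_comm]
  congr 1
  · refine Finset.sum_congr rfl fun i hi => ?_
    have hi' := Nat.lt_succ_iff.1 (Finset.mem_range.1 hi)
    rw [show (k : ℤ) - n + (n - i) = (k - i : ℕ) by omega, zpow_natCast]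
  · refine Finset.sum_congr rfl fun i hi => ?_
    congr 2
    ring

/-- `Δ_{j,n}` is the polynomial part of `z ^ {-(n+m-j)} P_n G`. -/
theorem zpow_smul_evalM_mul_sub_DeltaM {n m : ℕ} (hP : (P n).natDegree ≤ n) {G : (CMat N)[X]}
    (hG : G.natDegree ≤ m) {j : ℕ} (hj : j ≤ m) :
    EntrywiseBigO (fun z => z ^ (-((n : ℤ) + m - j)) • (evalM (P n) z * evalM G z)
      - DeltaM P m G j n z) fun z => z ^ (-1 : ℤ) := by
  have hPn := (isMatPoly_evalM (Nat.lt_succ_of_le hP)).entrywiseBigO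
  -- Coefficients `M_i` with `i < m - j` meet only negative powers of `z`; those with `i = m - j +
  -- k` meet `z^{k-n} P_n`, whose polynomial part is `P_{n,k}`.
  have h1 : EntrywiseBigO (fun z : ℂ => ∑ i ∈ Finset.range (m - j),
      (z ^ ((i : ℤ) - ((n : ℤ) + m - j)) • evalM (P n) z) * G.coeff i) fun z => z ^ (-1 : ℤ) := by
    refine EntrywiseBigO.sum fun i hi => ?_
    have hi' := Finset.mem_range.1 hi
    exact (hPn.zpow_smul (c := -1) (by omega)).mul_zpow (entrywiseBigO_const _ le_rfl) (by simp)
  have h2 : EntrywiseBigO (fun z : ℂ => ∑ k ∈ Finset.range (j + 1),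
      (z ^ ((k : ℤ) - n) • evalM (P n) z - PTrunc P n k z) * G.coeff (m - j + k))
      fun z => z ^ (-1 : ℤ) :=
    EntrywiseBigO.sum fun k _ => (zpow_smul_evalM_sub_PTrunc P hP k).mul_zpow
      (entrywiseBigO_const _ le_rfl) (by simp)
  refine (h1.add h2).congr' fun z hz => ?_
  have hz0 := ne_zero_of_im_ne_zero hz
  rw [evalM_eq_sum_range hG, show m + 1 = (m - j) + (j + 1) by omega, Finset.sum_range_add _ (m - j),
    DeltaM]
  simp only [sub_mul, Finset.sum_sub_distrib]
  rw [add_sub_assoc', mul_add, smul_add, Finset.mul_sum, Finset.mul_sum, Finset.smul_sum,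
    Finset.smul_sum]
  congr 2
  · refine Finset.sum_congr rfl fun i _ => ?_
    rw [mul_smul_comm, smul_smul, smul_mul_assoc, ← zpow_natCast z i, ← zpow_add₀ hz0]
    congr 2
    ring
  · refine Finset.sum_congr rfl fun i _ => ?_
    rw [mul_smul_comm, smul_smul, smul_mul_assoc, ← zpow_natCast z, ← zpow_add₀ hz0]
    congr 2
    push_cast [Nat.cast_sub hj]
    ring

/-- `e` lists the coefficients of the asymptotic expansion of `g` in powers of `1 / z`. -/
def HasExpansion (g : ℂ → CMat N) (e : ℕ → CMat N) : Prop :=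
  ∀ K : ℕ, EntrywiseBigO (fun z => g z - ∑ l ∈ Finset.range (K + 1), z ^ (-(l : ℤ)) • e l)
    fun z => z ^ (-((K : ℤ) + 1))

theorem HasExpansion.star {g : ℂ → CMat N} {e : ℕ → CMat N} (h : HasExpansion g e) :
    HasExpansion (starFun g) fun l => (e l).conjTranspose := by
  intro K
  refine (h K).star.congr' fun z _ => ?_
  simp [starFun, Matrix.conjTranspose_sum, Matrix.conjTranspose_smul]

/-- The polynomial part of `P_n G g`, for a function `g` with an asymptotic expansion. -/
theorem HasExpansion.evalM_mul_sub_sum_DeltaM {g : ℂ → CMat N} {e : ℕ → CMat N}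
    (h : HasExpansion g e) {n m J : ℕ} (hP : (P n).natDegree ≤ n) {G : (CMat N)[X]}
    (hG : G.natDegree ≤ m) (hJ : J ≤ m + 1) (he : ∀ l, l + J ≤ n + m → e l = 0) :
    EntrywiseBigO (fun z => evalM (P n) z * evalM G z * g z
      - ∑ j ∈ Finset.range J, DeltaM P m G j n z * e (n + m - j)) fun z => z ^ (-1 : ℤ) := by
  have hPn := (isMatPoly_evalM (Nat.lt_succ_of_le hP)).entrywiseBigO
  have hGm := (isMatPoly_evalM (Nat.lt_succ_of_le hG)).entrywiseBigO
  -- `P_n G` grows like `z^{n+m}`, so the expansion of `g` is needed exactly up to order `n + m`.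
  have h1 := (hPn.mul_zpow hGm le_rfl).mul_zpow (h (n + m)) (c := -1) (by push_cast; omega)
  have h2 : EntrywiseBigO (fun z : ℂ => ∑ j ∈ Finset.range J,
      (z ^ (-((n : ℤ) + m - j)) • (evalM (P n) z * evalM G z) - DeltaM P m G j n z)
        * e (n + m - j)) fun z => z ^ (-1 : ℤ) := by
    refine EntrywiseBigO.sum fun j hj => ?_
    have hj' := Finset.mem_range.1 hj
    exact (zpow_smul_evalM_mul_sub_DeltaM P hP hG (by omega)).mul_zpow
      (entrywiseBigO_const _ le_rfl) (by simp)
  refine (h1.add h2).congr' fun z hz => ?_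
  -- By `he` only the top `J` coefficients survive; they are listed downwards as `l = n + m - j`.
  have h3 : ∑ l ∈ Finset.range (n + m + 1), z ^ (-(l : ℤ)) • e l
      = ∑ j ∈ Finset.range J, z ^ (-((n : ℤ) + m - j)) • e (n + m - j) := by
    rw [← Finset.sum_range_reflect, show n + m + 1 = J + (n + m + 1 - J) by omega,
      Finset.sum_range_add, Finset.sum_eq_zero (s := .range (n + m + 1 - J)), add_zero]
    · refine Finset.sum_congr rfl fun j hj => ?_
      have hj' := Finset.mem_range.1 hj
      rw [show J + (n + m + 1 - J) - 1 - j = n + m - j by omega, Nat.cast_sub (by omega),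
        Nat.cast_add]
    · intro j hj
      have hj' := Finset.mem_range.1 hj
      rw [he _ (by omega), smul_zero]
  rw [h3, mul_sub, Finset.mul_sum]
  simp only [sub_mul, Finset.sum_sub_distrib, smul_mul_assoc, mul_smul_comm]
  abel

end PolynomialParts

/-! ### Entrywise holomorphy and the entire branches of `Y`. -/

section EntrywiseDifferentiable

variable {ι κ μ : Type*}

/-- All entries of `F` are holomorphic on `s`. -/
def EntrywiseDiffOn (F : ℂ → Matrix ι κ ℂ) (s : Set ℂ) : Prop :=
  ∀ i j, DifferentiableOn ℂ (fun z => F z i j) s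

theorem EntrywiseDiffOn.mul [Fintype κ] {F : ℂ → Matrix ι κ ℂ} {H : ℂ → Matrix κ μ ℂ} {s : Set ℂ}
    (hF : EntrywiseDiffOn F s) (hH : EntrywiseDiffOn H s) :
    EntrywiseDiffOn (fun z => F z * H z) s := by
  intro i j
  simp only [Matrix.mul_apply]
  exact DifferentiableOn.fun_sum fun k _ => (hF i k).mul (hH k j)

theorem EntrywiseDiffOn.add {F H : ℂ → Matrix ι κ ℂ} {s : Set ℂ}
    (hF : EntrywiseDiffOn F s) (hH : EntrywiseDiffOn H s) :
    EntrywiseDiffOn (fun z => F z + H z) s :=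
  fun i j => (hF i j).add (hH i j)

theorem EntrywiseDiffOn.sub {F H : ℂ → Matrix ι κ ℂ} {s : Set ℂ}
    (hF : EntrywiseDiffOn F s) (hH : EntrywiseDiffOn H s) :
    EntrywiseDiffOn (fun z => F z - H z) s :=
  fun i j => (hF i j).sub (hH i j)

theorem EntrywiseDiffOn.mono {F : ℂ → Matrix ι κ ℂ} {s t : Set ℂ} (hF : EntrywiseDiffOn F s)
    (h : t ⊆ s) : EntrywiseDiffOn F t :=
  fun i j => (hF i j).mono h

theorem EntrywiseDiffOn.differentiable {F : ℂ → Matrix ι κ ℂ} (hF : EntrywiseDiffOn F Set.univ)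
    (i : ι) (j : κ) : Differentiable ℂ fun z => F z i j :=
  differentiableOn_univ.1 (hF i j)

theorem entrywiseDiffOn_univ {F : ℂ → Matrix ι κ ℂ}
    (h : ∀ i j, Differentiable ℂ fun z => F z i j) : EntrywiseDiffOn F Set.univ :=
  fun i j => (h i j).differentiableOn

theorem entrywiseDiffOn_const (A : Matrix ι κ ℂ) (s : Set ℂ) : EntrywiseDiffOn (fun _ => A) s :=
  fun _ _ => differentiableOn_const _

theorem EntrywiseDiffOn.continuous {F : ℂ → Matrix ι κ ℂ} (hF : EntrywiseDiffOn F Set.univ) :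
    Continuous F :=
  continuous_matrix fun i j => (hF.differentiable i j).continuous

theorem EntrywiseDiffOn.fromBlocks {N : ℕ} {A B C D : ℂ → CMat N} {s : Set ℂ}
    (hA : EntrywiseDiffOn A s) (hB : EntrywiseDiffOn B s) (hC : EntrywiseDiffOn C s)
    (hD : EntrywiseDiffOn D s) :
    EntrywiseDiffOn (fun z => Matrix.fromBlocks (A z) (B z) (C z) (D z)) s := by
  rintro (i | i) (j | j)
  · exact hA i j
  · exact hB i j
  · exact hC i j
  · exact hD i j

theorem EntrywiseDiffOn.flip {N : ℕ} {F : ℂ → BMat N} (hF : EntrywiseDiffOn F Set.univ) :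
    EntrywiseDiffOn (flipFun F) Set.univ :=
  entrywiseDiffOn_univ fun i j => differentiable_flipFun hF.differentiable i j

theorem EntrywiseDiffOn.starFun {N : ℕ} {F : ℂ → CMat N} (hF : EntrywiseDiffOn F Set.univ) :
    EntrywiseDiffOn (starFun F) Set.univ := by
  refine entrywiseDiffOn_univ fun i j z => ?_
  have h := (hF.differentiable j i (starRingEnd ℂ z)).hasDerivAt.conj_conj
  rw [Complex.conj_conj] at h
  exact h.differentiableAt

theorem EntrywiseDiffOn.hasEDerivAt {F : ℂ → Matrix ι κ ℂ} {s : Set ℂ} (hs : IsOpen s)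
    (hF : EntrywiseDiffOn F s) {z : ℂ} (hz : z ∈ s) :
    HasEDerivAt F (Matrix.of fun i j => deriv (fun w => F w i j) z) z :=
  fun i j => ((hF i j).differentiableAt (hs.mem_nhds hz)).hasDerivAt

theorem HasEDerivAt.fromBlocks {N : ℕ} {A B C D : ℂ → CMat N} {A' B' C' D' : CMat N} {z : ℂ}
    (hA : HasEDerivAt A A' z) (hB : HasEDerivAt B B' z) (hC : HasEDerivAt C C' z)
    (hD : HasEDerivAt D D' z) :
    HasEDerivAt (fun z => Matrix.fromBlocks (A z) (B z) (C z) (D z))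
      (Matrix.fromBlocks A' B' C' D') z := by
  rintro (i | i) (j | j)
  · exact hA i j
  · exact hB i j
  · exact hC i j
  · exact hD i j

theorem HasEDerivAt.unique {F : ℂ → Matrix ι κ ℂ} {F₁ F₂ : Matrix ι κ ℂ} {z : ℂ}
    (h₁ : HasEDerivAt F F₁ z) (h₂ : HasEDerivAt F F₂ z) : F₁ = F₂ := by
  ext i j
  exact (h₁ i j).unique (h₂ i j)

end EntrywiseDifferentiable

section Branches

variable {N : ℕ} {W : ℝ → CMat N} {n : ℕ} {Y : ℂ → BMat N}

/-- Both half-plane branches of the solution of the Riemann–Hilbert problem are entire when the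
weight factors as `T T^*` with `T` entire and invertible. -/
theorem IsRHPSolution.exists_entire_branches (hY : IsRHPSolution W n Y) {T S : ℂ → CMat N}
    (hT : EntrywiseDiffOn T Set.univ) (hS : EntrywiseDiffOn S Set.univ) (hST : ∀ z, S z * T z = 1)
    (hW : ∀ x : ℝ, W x = T x * (T x).conjTranspose) :
    ∃ Yu Yl : ℂ → BMat N, EntrywiseDiffOn Yu Set.univ ∧ EntrywiseDiffOn Yl Set.univ ∧
      (∀ z : ℂ, 0 < z.im → Y z = Yu z) ∧ (∀ z : ℂ, z.im < 0 → Y z = Yl z) ∧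
      ∀ z, Yu z = Yl z * Matrix.fromBlocks 1 (T z * starFun T z) 0 1 := by
  set D : ℂ → BMat N := fun z => Matrix.fromBlocks (T z) 0 0 (starFun S z) with hD
  set E : ℂ → BMat N := fun z => Matrix.fromBlocks (S z) 0 0 (starFun T z) with hE
  set U : BMat N := Matrix.fromBlocks 1 1 0 1 with hU
  set U' : BMat N := Matrix.fromBlocks 1 (-1) 0 1 with hU'
  have hTS : ∀ z, T z * S z = 1 := fun z => mul_eq_one_comm.1 (hST z)
  have hTS' : ∀ z, starFun T z * starFun S z = 1 := by
    intro z
    rw [starFun, starFun, ← Matrix.conjTranspose_mul, hST, Matrix.conjTranspose_one]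
  have hDE : ∀ z, D z * E z = 1 := by
    intro z
    simp [hD, hE, Matrix.fromBlocks_multiply, hTS, mul_eq_one_comm.1 (hTS' z)]
  have hUU' : U * U' = 1 := by simp [hU, hU', Matrix.fromBlocks_multiply]
  have hz0 : ∀ s, EntrywiseDiffOn (fun _ : ℂ => (0 : CMat N)) s := fun s => entrywiseDiffOn_const 0 s
  have hDd : EntrywiseDiffOn D Set.univ := hT.fromBlocks (hz0 _) (hz0 _) hS.starFun
  have hEd : EntrywiseDiffOn E Set.univ := hS.fromBlocks (hz0 _) (hz0 _) hT.starFun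
  have hYD : EntrywiseDiffOn (fun z => Y z * D z) {z : ℂ | z.im ≠ 0} :=
    EntrywiseDiffOn.mul hY.analytic (hDd.mono (Set.subset_univ _))
  have hYDU := hYD.mul (entrywiseDiffOn_const U _)
  obtain ⟨Yp, Ym, -, -, hp, hm, hjump⟩ := hY.jump
  -- Since `W T^{-*} = T`, the jump of `Y D` is the constant `U`. Multiplying by `U` in the lower
  -- half plane removes it, so `f` extends to an entire function, from which both branches are
  -- recovered.
  set f : ℂ → BMat N := fun z => if 0 < z.im then Y z * D z else Y z * D z * U with hf
  have hopen1 : IsOpen {z : ℂ | 0 < z.im} := isOpen_lt continuous_const Complex.continuous_im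
  have hopen2 : IsOpen {z : ℂ | z.im < 0} := isOpen_lt Complex.continuous_im continuous_const
  have hext : ∀ i j, ∃ g : ℂ → ℂ, Differentiable ℂ g ∧ ∀ z : ℂ, z.im ≠ 0 → g z = f z i j := by
    intro i j
    refine exists_entire_extension (f := fun z => f z i j) (fun z hz => ?_) fun x => ?_
    · rcases lt_or_gt_of_ne (show z.im ≠ 0 from hz) with h | h
      · have h1 := (hYDU i j).differentiableAt (isOpen_im_ne_zero.mem_nhds hz)
        refine (h1.congr_of_eventuallyEq ?_).differentiableWithinAt
        filter_upwards [hopen2.mem_nhds h] with w hw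
        simp only [hf, if_neg (not_lt.2 (le_of_lt (show w.im < 0 from hw)))]
      · have h1 := (hYD i j).differentiableAt (isOpen_im_ne_zero.mem_nhds hz)
        refine (h1.congr_of_eventuallyEq ?_).differentiableWithinAt
        filter_upwards [hopen1.mem_nhds h] with w hw
        simp only [hf, if_pos (show 0 < w.im from hw)]
    · have hDx : ∀ s, Tendsto D (𝓝[s] (x : ℂ)) (𝓝 (D x)) := fun s =>
        (hDd.continuous.tendsto _).mono_left nhdsWithin_le_nhds
      have hentry : Continuous fun M : BMat N => M i j := by fun_prop
      have hval : Yp x * D x = Ym x * D x * U := by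
        have h1 : starFun T (x : ℂ) = (T x).conjTranspose := by rw [starFun, Complex.conj_ofReal]
        have h2 := hTS' x
        rw [h1] at h2
        rw [hjump, mul_assoc, mul_assoc]
        congr 1
        simp [hD, hU, Matrix.fromBlocks_multiply, hW, mul_assoc, h2]
      refine ⟨(Yp x * D x) i j, ?_, ?_⟩
      · refine (((hentry.tendsto _).comp ((hp x).mul (hDx _)))).congr' ?_
        filter_upwards [self_mem_nhdsWithin] with w hw
        simp only [hf, if_pos (show 0 < w.im from hw), Function.comp]
      · rw [hval]
        refine (((hentry.tendsto _).comp (((hm x).mul (hDx _)).mul_const U))).congr' ?_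
        filter_upwards [self_mem_nhdsWithin] with w hw
        simp only [hf, if_neg (not_lt.2 (le_of_lt (show w.im < 0 from hw))), Function.comp]
  choose g hg hgf using hext
  set Z : ℂ → BMat N := fun z => Matrix.of fun i j => g i j z with hZ
  have hZd : EntrywiseDiffOn Z Set.univ := entrywiseDiffOn_univ hg
  have hZf : ∀ z : ℂ, z.im ≠ 0 → Z z = f z := by
    intro z hz
    ext i j
    exact hgf i j z hz
  refine ⟨fun z => Z z * E z, fun z => Z z * U' * E z, hZd.mul hEd,
    (hZd.mul (entrywiseDiffOn_const U' _)).mul hEd, fun z hz => ?_, fun z hz => ?_, fun z => ?_⟩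
  · simp only [hZf z hz.ne', hf, if_pos hz]
    rw [mul_assoc, hDE, mul_one]
  · simp only [hZf z hz.ne, hf, if_neg hz.le.not_gt]
    rw [mul_assoc (Y z * D z), hUU', mul_one, mul_assoc, hDE, mul_one]
  · simp only [mul_assoc]
    congr 1
    simp [hE, hU', Matrix.fromBlocks_multiply, ← mul_assoc, hST]

end Branches

/-! ### Expansions at infinity and the moments they encode. -/

section Expansions

variable {N : ℕ}

/-- The expansion at infinity of `Y diag(z ^ {-n}, z ^ n)`. -/
theorem IsRHPSolution.exists_expansion {W : ℝ → CMat N} {n : ℕ} {Y : ℂ → BMat N}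
    (hY : IsRHPSolution W n Y) :
    ∃ Yc : ℕ → BMat N, Yc 0 = 1 ∧
      (∀ k : ℕ, EntrywiseBigO (fun z : ℂ =>
        Y z * Matrix.fromBlocks (z ^ (-(n : ℤ)) • (1 : CMat N)) 0 0 (z ^ (n : ℤ) • (1 : CMat N))
          - ∑ l ∈ Finset.range (k + 1), z ^ (-(l : ℤ)) • Yc l) fun z => z ^ (-((k : ℤ) + 1))) := by
  obtain ⟨Yc, h0, h⟩ := hY.asymptotics
  refine ⟨Yc, h0, fun k i j => ?_⟩
  have e : (fun z : ℂ => z ^ (-((k : ℤ) + 1))) = fun z : ℂ => (z ^ (k + 1))⁻¹ := by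
    funext z
    rw [zpow_neg, ← zpow_natCast]; simp
  rw [e]
  simp only [zpow_neg, zpow_natCast]
  exact h k i j

end Expansions

section Identification

variable {N : ℕ}

theorem HasExpansion.congr_fun {g h : ℂ → CMat N} {e : ℕ → CMat N} (hg : HasExpansion g e)
    (hgh : ∀ z : ℂ, z.im ≠ 0 → g z = h z) : HasExpansion h e :=
  fun K => (hg K).congr' fun z hz => by rw [hgh z hz]

theorem HasExpansion.isBigO_one {g : ℂ → CMat N} {e : ℕ → CMat N} (hg : HasExpansion g e) :
    EntrywiseBigO g fun z => z ^ (0 : ℤ) := by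
  refine (((hg 0).trans (isBigO_zpow_mono (by simp))).add
    (entrywiseBigO_const (e 0) le_rfl)).congr' fun z _ => ?_
  simp

theorem HasExpansion.zpow_smul {g : ℂ → CMat N} {e : ℕ → CMat N} (hg : HasExpansion g e) (n : ℕ) :
    HasExpansion (fun z => z ^ (-(n : ℤ)) • g z) fun l => if l < n then 0 else e (l - n) := by
  intro K
  rcases lt_or_ge K n with hK | hK
  · refine (hg.isBigO_one.zpow_smul (b := -(n : ℤ)) (c := -((K : ℤ) + 1)) (by omega)).congr'
      fun z _ => ?_
    rw [Finset.sum_eq_zero, sub_zero]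
    intro l hl
    have := Finset.mem_range.1 hl
    beta_reduce
    rw [if_pos (by omega), smul_zero]
  · obtain ⟨k, rfl⟩ := Nat.exists_eq_add_of_le hK
    refine ((hg k).zpow_smul (b := -(n : ℤ)) (by push_cast; omega)).congr' fun z hz => ?_
    beta_reduce
    rw [add_assoc, Finset.sum_range_add _ n, Finset.sum_eq_zero (s := .range n), zero_add, smul_sub,
      Finset.smul_sum]
    · congr 1
      refine Finset.sum_congr rfl fun l _ => ?_
      rw [if_neg (by omega), smul_smul, ← zpow_add₀ (ne_zero_of_im_ne_zero hz),
        Nat.add_sub_cancel_left]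
      congr 2
      push_cast; ring
    · intro l hl
      rw [if_pos (Finset.mem_range.1 hl), smul_zero]

/-- An entire matrix function of polynomial growth is a matrix polynomial. -/
theorem HasExpansion.exists_polynomial {F g : ℂ → CMat N} {e : ℕ → CMat N}
    (hg : HasExpansion g e) (hF : EntrywiseDiffOn F Set.univ) {n : ℕ}
    (h : ∀ z : ℂ, z.im ≠ 0 → F z = z ^ (n : ℤ) • g z) :
    ∃ Q : (CMat N)[X], Q.natDegree ≤ n ∧ Q.coeff n = e 0 ∧ ∀ z, F z = evalM Q z := by
  -- The polynomial part of `z^n g`; the difference from `F` is entire and `O(1/z)`, hence zero.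
  set Q : (CMat N)[X] := ∑ l ∈ Finset.range (n + 1), monomial (n - l) (e l) with hQ
  have hdeg : Q.natDegree ≤ n :=
    natDegree_sum_le_of_forall_le _ _ fun l _ => (natDegree_monomial_le _).trans (Nat.sub_le _ _)
  refine ⟨Q, hdeg, ?_, fun z => ?_⟩
  · rw [hQ, finsetSum_coeff, Finset.sum_eq_single 0]
    · simp
    · intro l hl hl0
      have := Finset.mem_range.1 hl
      rw [coeff_monomial, if_neg (by omega)]
    · simp
  · have hQd : EntrywiseDiffOn (evalM Q) Set.univ :=
      entrywiseDiffOn_univ (isMatPoly_evalM (Nat.lt_succ_of_le hdeg)).differentiable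
    refine sub_eq_zero.1 (EntrywiseBigO.eq_zero (hF.sub hQd).differentiable
      (EntrywiseBigO.trans ?_ isBigO_zpow_neg_one_inv_im) z)
    refine ((hg n).zpow_smul (b := (n : ℤ)) (c := -1) (by omega)).congr' fun z hz => ?_
    rw [h z hz, smul_sub, hQ, evalM_sum, Finset.smul_sum]
    congr 1
    refine Finset.sum_congr rfl fun l hl => ?_
    have := Finset.mem_range.1 hl
    rw [evalM_monomial, smul_smul, ← zpow_add₀ (ne_zero_of_im_ne_zero hz), ← zpow_natCast,
      Nat.cast_sub (by omega)]
    rfl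

/-- The moments of `Q W` are the coefficients of the expansion at infinity of a sectionally entire
function with jump `Q W` on the real line. -/
theorem HasExpansion.momW_eq {W : ℝ → CMat N} (hW : IsWeight W) {Q : (CMat N)[X]}
    {f u l : ℂ → CMat N} {d : ℕ → CMat N} (hf : HasExpansion f d)
    (hu : EntrywiseDiffOn u Set.univ) (hl : EntrywiseDiffOn l Set.univ)
    (hfu : ∀ z : ℂ, 0 < z.im → f z = u z) (hfl : ∀ z : ℂ, z.im < 0 → f z = l z)
    (hj : ∀ x : ℝ, u x - l x = evalM Q x * W x) (s : ℕ) :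
    momW W Q s = (-(2 * Real.pi * Complex.I) : ℂ) • d (s + 1) := by
  ext i j
  -- Multiplying by `z^s` and removing the polynomial part leaves `d_{s+1} / z + O(z⁻²)`. The same
  -- polynomial is removed in both half planes, so it drops out of the jump.
  have hcong : ∀ (v : ℂ → CMat N) (t : Set ℂ), (∀ z ∈ t, z.im ≠ 0) → (∀ z ∈ t, f z = v z) →
      (fun z => (z ^ s * v z i j - ∑ k ∈ Finset.range (s + 1), z ^ (s - k) * d k i j)
        - d (s + 1) i j * z⁻¹) =O[cocompact ℂ ⊓ 𝓟 t] fun z => (z ^ 2)⁻¹ := by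
    intro v t ht hv
    have h1 := ((hf (s + 1)).zpow_smul (b := (s : ℤ)) (c := -2) (by push_cast; omega)) i j
    have h2 : (fun z : ℂ => z ^ (-2 : ℤ)) = fun z => (z ^ 2)⁻¹ := by
      funext z; rw [zpow_neg]; rfl
    rw [h2] at h1
    have hle : cocompact ℂ ⊓ 𝓟 t ≤ offReal := inf_le_inf_left _ (principal_mono.2 ht)
    refine (h1.mono hle).congr' ?_ EventuallyEq.rfl
    filter_upwards [eventually_inf_principal.2 (Eventually.of_forall fun _ h => h)] with z hz
    have hz0 := ne_zero_of_im_ne_zero (ht z hz)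
    rw [Finset.sum_range_succ, Matrix.smul_apply, Matrix.sub_apply, Matrix.add_apply, hv z hz,
      Matrix.sum_apply, smul_eq_mul, mul_sub, mul_add, Finset.mul_sum, zpow_natCast]
    rw [sub_sub]
    congr 2
    · refine Finset.sum_congr rfl fun k hk => ?_
      have := Finset.mem_range.1 hk
      rw [Matrix.smul_apply, smul_eq_mul, ← mul_assoc, ← zpow_natCast, ← zpow_natCast,
        ← zpow_add₀ hz0, Nat.cast_sub (by omega)]
      rfl
    · rw [Matrix.smul_apply, smul_eq_mul, ← mul_assoc, ← zpow_natCast, ← zpow_add₀ hz0, mul_comm,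
        ← zpow_neg_one]
      congr 2
      push_cast; ring
  have hdiff : ∀ v : ℂ → CMat N, EntrywiseDiffOn v Set.univ → Differentiable ℂ fun z =>
      z ^ s * v z i j - ∑ k ∈ Finset.range (s + 1), z ^ (s - k) * d k i j := by
    intro v hv
    have := hv.differentiable i j
    fun_prop
  have hsub : ∀ x : ℝ,
      ((x : ℂ) ^ s * u x i j - ∑ k ∈ Finset.range (s + 1), (x : ℂ) ^ (s - k) * d k i j)
        - ((x : ℂ) ^ s * l x i j - ∑ k ∈ Finset.range (s + 1), (x : ℂ) ^ (s - k) * d k i j)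
      = ((x : ℂ) ^ s • (evalM Q x * W x)) i j := by
    intro x
    rw [← hj x, Matrix.smul_apply, Matrix.sub_apply, smul_eq_mul]
    ring
  have key := integral_sub_eq_residue (hdiff u hu) (hdiff l hl) (c := d (s + 1) i j)
    (hcong u _ (fun z hz => (show 0 < z.im from hz).ne') hfu)
    (hcong l _ (fun z hz => (show z.im < 0 from hz).ne) hfl) (by
      simp only [hsub]
      exact hW.integrableM Q s i j)
  simp only [hsub] at key
  rw [Matrix.smul_apply, smul_eq_mul, neg_mul]
  exact key

end Identification

section RiemannHilbert

variable {N : ℕ} {W : ℝ → CMat N} {P : ℕ → (CMat N)[X]} {κ : ℕ → CMat N} {n : ℕ} {Y : ℂ → BMat N}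

theorem IsRHPSolution.exists_block_expansions (hY : IsRHPSolution W n Y) :
    ∃ Yc : ℕ → BMat N, Yc 0 = 1 ∧
      HasExpansion (fun z => z ^ (-(n : ℤ)) • (Y z).toBlocks₁₁) (fun l => (Yc l).toBlocks₁₁) ∧
      HasExpansion (fun z => z ^ (n : ℤ) • (Y z).toBlocks₁₂) (fun l => (Yc l).toBlocks₁₂) ∧
      HasExpansion (fun z => z ^ (-(n : ℤ)) • (Y z).toBlocks₂₁) (fun l => (Yc l).toBlocks₂₁) ∧
      HasExpansion (fun z => z ^ (n : ℤ) • (Y z).toBlocks₂₂) (fun l => (Yc l).toBlocks₂₂) := by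
  obtain ⟨Yc, h0, h⟩ := hY.exists_expansion
  have e : ∀ z : ℂ,
      Y z * Matrix.fromBlocks (z ^ (-(n : ℤ)) • (1 : CMat N)) 0 0 (z ^ (n : ℤ) • (1 : CMat N)) =
      Matrix.fromBlocks (z ^ (-(n : ℤ)) • (Y z).toBlocks₁₁) (z ^ (n : ℤ) • (Y z).toBlocks₁₂)
        (z ^ (-(n : ℤ)) • (Y z).toBlocks₂₁) (z ^ (n : ℤ) • (Y z).toBlocks₂₂) := by
    intro z
    conv_lhs => rw [← Matrix.fromBlocks_toBlocks (Y z)]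
    simp [Matrix.fromBlocks_multiply]
  simp only [e] at h
  refine ⟨Yc, h0, fun K i j => ?_, fun K i j => ?_, fun K i j => ?_, fun K i j => ?_⟩
  · refine (h K (Sum.inl i) (Sum.inl j)).congr_left fun z => ?_
    simp only [Matrix.sub_apply, Matrix.sum_apply]
    rfl
  · refine (h K (Sum.inl i) (Sum.inr j)).congr_left fun z => ?_
    simp only [Matrix.sub_apply, Matrix.sum_apply]
    rfl
  · refine (h K (Sum.inr i) (Sum.inl j)).congr_left fun z => ?_
    simp only [Matrix.sub_apply, Matrix.sum_apply]
    rfl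
  · refine (h K (Sum.inr i) (Sum.inr j)).congr_left fun z => ?_
    simp only [Matrix.sub_apply, Matrix.sum_apply]
    rfl

theorem smul_cancel_zpow {z : ℂ} (hz : z.im ≠ 0) (n : ℤ) (A : CMat N) :
    z ^ n • z ^ (-n) • A = A := by
  rw [smul_smul, ← zpow_add₀ (ne_zero_of_im_ne_zero hz), add_neg_cancel, zpow_zero, one_smul]

theorem smul_cancel_zpow' {z : ℂ} (hz : z.im ≠ 0) (n : ℤ) (A : CMat N) :
    z ^ (-n) • z ^ n • A = A := by
  rw [smul_smul, ← zpow_add₀ (ne_zero_of_im_ne_zero hz), neg_add_cancel, zpow_zero, one_smul]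

theorem two_pi_I_ne_zero : (2 * Real.pi * Complex.I : ℂ) ≠ 0 := by
  simp [Real.pi_ne_zero]

/-- The coefficient of `z^{-l}` is the moment of order `l - 1`; for `l = 0` the index is `-1`, where
`b` is zero by convention. -/
theorem IsMOPRL.bCoeff_natCast_sub_one (hW : IsWeight W) (hP : IsMOPRL W P κ) (n l : ℕ) :
    bCoeff W P n ((l : ℤ) - 1) = if l = 0 then 0 else momW W (P n) (l - 1) := by
  rcases l with _ | l
  · rw [if_pos rfl, bCoeff, if_pos (by push_cast; omega)]
  · rw [if_neg (by omega), ← hP.bCoeff_eq hW]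
    congr 1
    push_cast
    simp

/-- A row `(a, b)` of the solution: `a` is a matrix polynomial, and the moments of `a W` are the
coefficients of the expansion of `b`. -/
theorem exists_row_polynomial (hW : IsWeight W) {a b u l V : ℂ → CMat N} {n : ℕ} {α β : ℕ → CMat N}
    (ha : HasExpansion (fun z => z ^ (-(n : ℤ)) • a z) α)
    (hb : HasExpansion (fun z => z ^ (n : ℤ) • b z) β) {F : ℂ → CMat N}
    (hF : EntrywiseDiffOn F Set.univ) (hFa : ∀ z : ℂ, z.im ≠ 0 → a z = F z)
    (hu : EntrywiseDiffOn u Set.univ) (hl : EntrywiseDiffOn l Set.univ)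
    (hfu : ∀ z : ℂ, 0 < z.im → b z = u z) (hfl : ∀ z : ℂ, z.im < 0 → b z = l z)
    (hj : ∀ z : ℂ, u z = F z * V z + l z) (hV : ∀ x : ℝ, V x = W x) :
    ∃ Q : (CMat N)[X], Q.natDegree ≤ n ∧ Q.coeff n = α 0 ∧ (∀ z : ℂ, z.im ≠ 0 → a z = evalM Q z) ∧
      HasExpansion b (fun l => if l < n then 0 else β (l - n)) ∧
      ∀ s, momW W Q s = (-(2 * Real.pi * Complex.I) : ℂ) •
        (if s + 1 < n then 0 else β (s + 1 - n)) := by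
  obtain ⟨Q, hQ, hQn, hFQ⟩ := ha.exists_polynomial hF (n := n) fun z hz => by
    rw [smul_cancel_zpow hz, hFa z hz]
  have hb' := (hb.zpow_smul n).congr_fun fun z hz => smul_cancel_zpow' hz n (b z)
  refine ⟨Q, hQ, hQn, fun z hz => by rw [hFa z hz, hFQ], hb', fun s => ?_⟩
  refine hb'.momW_eq hW hu hl hfu hfl (fun x => ?_) s
  rw [hj, hV, hFQ, add_sub_cancel_right]

end RiemannHilbert

/-! ### Identification of the rows of `Y` with the orthogonal polynomials. -/

section Rows

variable {N : ℕ} {W : ℝ → CMat N} {P : ℕ → (CMat N)[X]} {κ : ℕ → CMat N}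
  {Y Yu Yl : ℂ → BMat N} {V : ℂ → CMat N}

theorem toBlocks_of_jump {A B : BMat N} {v : CMat N}
    (h : A = B * Matrix.fromBlocks 1 v 0 1) :
    A.toBlocks₁₁ = B.toBlocks₁₁ ∧ A.toBlocks₁₂ = B.toBlocks₁₁ * v + B.toBlocks₁₂ ∧
      A.toBlocks₂₁ = B.toBlocks₂₁ ∧ A.toBlocks₂₂ = B.toBlocks₂₁ * v + B.toBlocks₂₂ := by
  have h2 : A = Matrix.fromBlocks B.toBlocks₁₁ (B.toBlocks₁₁ * v + B.toBlocks₁₂)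
      B.toBlocks₂₁ (B.toBlocks₂₁ * v + B.toBlocks₂₂) := by
    rw [h]
    conv_lhs => rw [← Matrix.fromBlocks_toBlocks B]
    simp [Matrix.fromBlocks_multiply]
  rw [h2]
  exact ⟨rfl, rfl, rfl, rfl⟩

/-- The first row of the solution: `P_n` and its Cauchy-type transform. -/
theorem IsRHPSolution.first_row {n : ℕ} (hW : IsWeight W) (hP : IsMOPRL W P κ)
    (hY : IsRHPSolution W n Y) (hYu : EntrywiseDiffOn Yu Set.univ)
    (hYl : EntrywiseDiffOn Yl Set.univ) (hu : ∀ z : ℂ, 0 < z.im → Y z = Yu z)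
    (hl : ∀ z : ℂ, z.im < 0 → Y z = Yl z)
    (hj : ∀ z, Yu z = Yl z * Matrix.fromBlocks 1 (V z) 0 1) (hV : ∀ x : ℝ, V x = W x) :
    (∀ z : ℂ, z.im ≠ 0 → (Y z).toBlocks₁₁ = evalM (P n) z) ∧
      HasExpansion (fun z => (Y z).toBlocks₁₂)
        fun l => (-(1 / (2 * Real.pi * Complex.I)) : ℂ) • bCoeff W P n ((l : ℤ) - 1) := by
  obtain ⟨Yc, h0, h11, h12, -, -⟩ := hY.exists_block_expansions
  obtain ⟨Q, hQ, hQn, haQ, hb, hmom⟩ := exists_row_polynomial hW h11 h12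
    (F := fun z => (Yl z).toBlocks₁₁) (u := fun z => (Yu z).toBlocks₁₂)
    (l := fun z => (Yl z).toBlocks₁₂) (V := V) (fun i j => hYl (Sum.inl i) (Sum.inl j))
    (fun z hz => by
      rcases lt_or_gt_of_ne hz with h | h
      · rw [hl z h]
      · rw [hu z h, (toBlocks_of_jump (hj z)).1])
    (fun i j => hYu (Sum.inl i) (Sum.inr j)) (fun i j => hYl (Sum.inl i) (Sum.inr j))
    (fun z hz => by rw [hu z hz]) (fun z hz => by rw [hl z hz])
    (fun z => (toBlocks_of_jump (hj z)).2.1) hV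
  rw [h0] at hQn
  have h012 : (Yc 0).toBlocks₁₂ = 0 := by rw [h0]; ext i j; simp [Matrix.toBlocks₁₂]
  -- For `k + 1 < n` the moment is zero because `Y₁₂` starts at order `z^{-n}`; the case `k + 1 = n`
  -- uses that the off-diagonal block of the leading term `I` is zero.
  have hQP : Q = P n := by
    refine hP.eq_of_monic hW hQ ?_ fun k hk => ?_
    · rw [hQn]; ext i j; simp [Matrix.toBlocks₁₁, Matrix.one_apply]
    · rw [hmom k]
      split_ifs with h
      · simp
      · rw [show k + 1 - n = 0 by omega, h012, smul_zero]
  subst hQP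
  refine ⟨haQ, ?_⟩
  convert hb using 1
  funext l
  rw [hP.bCoeff_natCast_sub_one hW]
  rcases l with _ | s
  · simp [h012]
  · rw [if_neg (by omega), Nat.add_sub_cancel, hmom s, smul_smul]
    have : (-(1 / (2 * Real.pi * Complex.I)) * -(2 * Real.pi * Complex.I) : ℂ) = 1 := by
      have := two_pi_I_ne_zero
      field_simp
    rw [this, one_smul]

/-- The common part of the cases `n = 0` and `n ≥ 1`. The leading term `I` contributes `0` to the
coefficient of `z^n` in `Y₂₁` and `1` to the normalization of `Y₂₂`. -/
theorem IsRHPSolution.second_row_data {n : ℕ} (hW : IsWeight W)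
    (hY : IsRHPSolution W n Y) (hYu : EntrywiseDiffOn Yu Set.univ)
    (hYl : EntrywiseDiffOn Yl Set.univ) (hu : ∀ z : ℂ, 0 < z.im → Y z = Yu z)
    (hl : ∀ z : ℂ, z.im < 0 → Y z = Yl z)
    (hj : ∀ z, Yu z = Yl z * Matrix.fromBlocks 1 (V z) 0 1) (hV : ∀ x : ℝ, V x = W x) :
    ∃ (Q : (CMat N)[X]) (β : ℕ → CMat N), Q.natDegree ≤ n ∧ Q.coeff n = 0 ∧ β 0 = 1 ∧
      (∀ z : ℂ, z.im ≠ 0 → (Y z).toBlocks₂₁ = evalM Q z) ∧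
      HasExpansion (fun z => (Y z).toBlocks₂₂) (fun l => if l < n then 0 else β (l - n)) ∧
      ∀ s, momW W Q s = (-(2 * Real.pi * Complex.I) : ℂ) •
        (if s + 1 < n then 0 else β (s + 1 - n)) := by
  obtain ⟨Yc, h0, -, -, h21, h22⟩ := hY.exists_block_expansions
  obtain ⟨Q, hQ, hQn, haQ, hb, hmom⟩ := exists_row_polynomial hW h21 h22
    (F := fun z => (Yl z).toBlocks₂₁) (u := fun z => (Yu z).toBlocks₂₂)
    (l := fun z => (Yl z).toBlocks₂₂) (V := V) (fun i j => hYl (Sum.inr i) (Sum.inl j))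
    (fun z hz => by
      rcases lt_or_gt_of_ne hz with h | h
      · rw [hl z h]
      · rw [hu z h, (toBlocks_of_jump (hj z)).2.2.1])
    (fun i j => hYu (Sum.inr i) (Sum.inr j)) (fun i j => hYl (Sum.inr i) (Sum.inr j))
    (fun z hz => by rw [hu z hz]) (fun z hz => by rw [hl z hz])
    (fun z => (toBlocks_of_jump (hj z)).2.2.2) hV
  refine ⟨Q, fun l => (Yc l).toBlocks₂₂, hQ, ?_, ?_, haQ, hb, hmom⟩
  · rw [hQn, h0]; ext i j; simp [Matrix.toBlocks₂₁]
  · beta_reduce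
    rw [h0]; ext i j; simp [Matrix.toBlocks₂₂, Matrix.one_apply]

/-- The second row of the solution of index `n + 1`. -/
theorem IsRHPSolution.second_row_succ {n : ℕ} (hW : IsWeight W) (hP : IsMOPRL W P κ)
    (hY : IsRHPSolution W (n + 1) Y) (hYu : EntrywiseDiffOn Yu Set.univ)
    (hYl : EntrywiseDiffOn Yl Set.univ) (hu : ∀ z : ℂ, 0 < z.im → Y z = Yu z)
    (hl : ∀ z : ℂ, z.im < 0 → Y z = Yl z)
    (hj : ∀ z, Yu z = Yl z * Matrix.fromBlocks 1 (V z) 0 1) (hV : ∀ x : ℝ, V x = W x) :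
    (∀ z : ℂ, z.im ≠ 0 → (Y z).toBlocks₂₁ =
      (-(2 * Real.pi * Complex.I) : ℂ) • (gammaM κ n * evalM (P n) z)) ∧
      HasExpansion (fun z => (Y z).toBlocks₂₂)
        fun l => gammaM κ n * bCoeff W P n ((l : ℤ) - 1) := by
  obtain ⟨Q, β, hQ, hQn, hβ, haQ, hb, hmom⟩ := hY.second_row_data hW hYu hYl hu hl hj hV
  have hQ' : Q.natDegree ≤ n := by
    rw [natDegree_le_iff_coeff_eq_zero]
    intro k hk
    rcases (Nat.succ_le_of_lt hk).eq_or_lt with h | h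
    · rw [← h]; exact hQn
    · exact coeff_eq_zero_of_natDegree_lt (hQ.trans_lt h)
  -- `Y₂₂` starts at order `z^{-(n+1)}` with coefficient `I`. So the moments of `Q W` below `n`
  -- vanish, making `Q` a left multiple of `P n`, and the `n`-th moment, `-2πi I`, fixes the
  -- multiple.
  have hQP := hP.eq_C_mul hW hQ' fun k hk => by
    rw [hmom k, if_pos (by omega), smul_zero]
  have hn : momW W Q n = (-(2 * Real.pi * Complex.I) : ℂ) • (1 : CMat N) := by
    rw [hmom n, if_neg (by omega), Nat.sub_self, hβ]
  rw [hn, smul_mul_assoc, one_mul] at hQP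
  have hQmom : ∀ s, momW W Q s =
      (-(2 * Real.pi * Complex.I) : ℂ) • (gammaM κ n * momW W (P n) s) := by
    intro s
    conv_lhs => rw [hQP]
    rw [momW_C_mul hW, smul_mul_assoc]
  refine ⟨fun z hz => ?_, ?_⟩
  · rw [haQ z hz]
    conv_lhs => rw [hQP]
    rw [evalM_C_mul, smul_mul_assoc]
  · convert hb using 1
    funext l
    rw [hP.bCoeff_natCast_sub_one hW]
    rcases l with _ | s
    · simp
    · rw [if_neg (by omega), Nat.add_sub_cancel]
      have h1 := (hQmom s).symm.trans (hmom s)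
      exact smul_right_injective _ (neg_ne_zero.2 two_pi_I_ne_zero) h1

/-- The second row of the solution of index `0`. -/
theorem IsRHPSolution.second_row_zero (hW : IsWeight W)
    (hY : IsRHPSolution W 0 Y) (hYu : EntrywiseDiffOn Yu Set.univ)
    (hYl : EntrywiseDiffOn Yl Set.univ) (hu : ∀ z : ℂ, 0 < z.im → Y z = Yu z)
    (hl : ∀ z : ℂ, z.im < 0 → Y z = Yl z)
    (hj : ∀ z, Yu z = Yl z * Matrix.fromBlocks 1 (V z) 0 1) (hV : ∀ x : ℝ, V x = W x) :
    (∀ z : ℂ, z.im ≠ 0 → (Y z).toBlocks₂₁ = 0) ∧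
      HasExpansion (fun z => (Y z).toBlocks₂₂) fun l => if l = 0 then 1 else 0 := by
  obtain ⟨Q, β, hQ, hQn, hβ, haQ, hb, hmom⟩ := hY.second_row_data hW hYu hYl hu hl hj hV
  have hQ0 : Q = 0 := by
    rw [eq_C_of_natDegree_le_zero hQ, hQn, C_0]
  refine ⟨fun z hz => by rw [haQ z hz, hQ0, evalM_zero], ?_⟩
  convert hb using 1
  funext l
  rcases l with _ | s
  · simp [hβ]
  -- The moments of the zero polynomial vanish, so `Y₂₂` equals `I` to all orders.
  · have h1 := hmom s
    have h2 : momW W (0 : (CMat N)[X]) s = 0 := by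
      ext i j; simp [momW, intM, evalM_zero]
    rw [hQ0, h2] at h1
    have h3 := (smul_eq_zero.1 h1.symm).resolve_left (neg_ne_zero.2 two_pi_I_ne_zero)
    rw [if_neg (by omega)]
    exact h3.symm

end Rows

/-! ### The polynomial part of `Y diag(G, -G^*) Y⁻¹`, block by block. -/

section CoefficientMatrix

variable {N : ℕ} {W : ℝ → CMat N} {P : ℕ → (CMat N)[X]} {κ : ℕ → CMat N} {m : ℕ}
  {G : (CMat N)[X]}

theorem gammaM_conjTranspose (κ : ℕ → CMat N) (n : ℕ) :
    (gammaM κ n).conjTranspose = gammaM κ n := by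
  simp [gammaM]

theorem EntrywiseBigO.fromBlocks {A B C D : ℂ → CMat N} {g : ℂ → ℂ} (hA : EntrywiseBigO A g)
    (hB : EntrywiseBigO B g) (hC : EntrywiseBigO C g) (hD : EntrywiseBigO D g) :
    EntrywiseBigO (fun z => Matrix.fromBlocks (A z) (B z) (C z) (D z)) g := by
  rintro (i | i) (j | j)
  · exact hA i j
  · exact hB i j
  · exact hC i j
  · exact hD i j

theorem starFun_sub (F H : ℂ → CMat N) :
    starFun (fun z => F z - H z) = fun z => starFun F z - starFun H z := by
  funext z; simp [starFun]

theorem starFun_smul (c : ℂ) (F : ℂ → CMat N) :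
    starFun (fun z => c • F z) = fun z => starRingEnd ℂ c • starFun F z := by
  funext z; simp [starFun, Matrix.conjTranspose_smul]

theorem conj_two_pi_I : starRingEnd ℂ (2 * Real.pi * Complex.I) = -(2 * Real.pi * Complex.I) := by
  rw [map_mul, map_mul, Complex.conj_I, Complex.conj_ofReal, map_ofNat, mul_neg]

theorem conj_inv_two_pi_I :
    starRingEnd ℂ (1 / (2 * Real.pi * Complex.I)) = -(1 / (2 * Real.pi * Complex.I)) := by
  rw [map_div₀, conj_two_pi_I, map_one, div_neg]

/-- The sum `∑_{j < J} Δ_{j,n} b_{k,c-j}^*`. -/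
noncomputable def sumDelta (W : ℝ → CMat N) (P : ℕ → (CMat N)[X]) (m : ℕ) (G : (CMat N)[X]) (J n k : ℕ) (c : ℤ)
    (z : ℂ) : CMat N :=
  ∑ j ∈ Finset.range J, DeltaM P m G j n z * (bCoeff W P k (c - j)).conjTranspose

theorem starFun_sumDelta (J n k : ℕ) (c : ℤ) (z : ℂ) :
    starFun (sumDelta W P m G J n k c) z =
      ∑ j ∈ Finset.range J, bCoeff W P k (c - j) * starFun (DeltaM P m G j n) z := by
  simp [starFun, sumDelta, Matrix.conjTranspose_sum]

/-- The off-diagonal blocks arise as a function minus its star. The imaginary factor `2πi` or its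
inverse turns this difference into the sum of `sumDelta` and its star. -/
theorem calA_eq_sumDelta (n : ℕ) (z : ℂ) :
    calA W P κ m G n z = -(gammaM κ n * (sumDelta W P m G m n n (n + m - 1) z
      + starFun (sumDelta W P m G m n n (n + m - 1)) z)) := by
  rw [starFun_sumDelta, sumDelta, ← Finset.sum_add_distrib, calA]
  congr 2
  refine Finset.sum_congr rfl fun j _ => ?_
  rw [add_comm, sub_right_comm]

theorem calB_eq_sumDelta (n : ℕ) (z : ℂ) :
    calB W P κ m G (n + 1) z = -((sumDelta W P m G (m + 1) (n + 1) n (n + m) z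
      + starFun (sumDelta W P m G (m + 1) n (n + 1) (n + m - 1)) z) * gammaM κ n) := by
  rw [starFun_sumDelta, sumDelta, ← Finset.sum_add_distrib, calB]
  congr 2
  refine Finset.sum_congr rfl fun j _ => ?_
  rw [show ((n + 1 : ℕ) : ℤ) + m - j - 1 = n + m - j by push_cast; ring,
    show ((n + 1 : ℕ) : ℤ) + m - j - 2 = n + m - 1 - j by push_cast; ring]

/-- The polynomial part of `P_n G f^*`, for `f` with coefficients `A b_{k,l-1}`. -/
theorem HasExpansion.sub_sumDelta {f : ℂ → CMat N} {A : CMat N} {n k J : ℕ}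
    (hf : HasExpansion f fun l => A * bCoeff W P k ((l : ℤ) - 1))
    (hP : (P n).natDegree ≤ n) (hG : G.natDegree ≤ m) (hJ : J ≤ m + 1) (hk : n + m ≤ k + J) :
    EntrywiseBigO (fun z => evalM (P n) z * evalM G z * starFun f z
      - sumDelta W P m G J n k (n + m - 1) z * A.conjTranspose) fun z => z ^ (-1 : ℤ) := by
  refine (hf.star.evalM_mul_sub_sum_DeltaM P hP hG hJ fun l hl => ?_).congr' fun z _ => ?_
  -- A coefficient not listed has `l ≤ n + m - J ≤ k`, so `b_{k,l-1}` is below the diagonal and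
  -- zero; this is what `hk` is for.
  · rw [bCoeff, if_pos (by omega)]; simp
  · rw [sumDelta, Finset.sum_mul]
    congr 1
    refine Finset.sum_congr rfl fun j hj => ?_
    have := Finset.mem_range.1 hj
    rw [Matrix.conjTranspose_mul, mul_assoc]
    congr 4
    omega

/-- The upper right block. -/
theorem upperRight_asymptotics (hW : IsWeight W) (hP : IsMOPRL W P κ) (hG : G.natDegree ≤ m)
    {n : ℕ} {b : ℂ → CMat N} (hb : HasExpansion b
      fun l => (-(1 / (2 * Real.pi * Complex.I)) : ℂ) • bCoeff W P n ((l : ℤ) - 1)) :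
    EntrywiseBigO (fun z => evalM (P n) z * evalM G z * starFun b z
        - b z * starFun (evalM G) z * starFun (evalM (P n)) z
        - -((1 / (2 * Real.pi * Complex.I) : ℂ) • ((gammaM κ n)⁻¹ * calA W P κ m G n z)))
      fun z => z ^ (-1 : ℤ) := by
  set c : ℂ := 1 / (2 * Real.pi * Complex.I) with hc
  have hb' : HasExpansion b fun l => ((-c) • (1 : CMat N)) * bCoeff W P n ((l : ℤ) - 1) := by
    simpa using hb
  have h := hb'.sub_sumDelta (J := m) (hP.natDegree_le n) hG (by omega) le_rfl
  have hγ := hP.momW_self_mul_gammaM hW n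
  refine (h.sub h.star).congr' fun z _ => ?_
  rw [hP.gammaM_inv hW, calA_eq_sumDelta, mul_neg, ← mul_assoc (momW W (P n) n), hγ, one_mul,
    starFun_sub, starFun_mul, starFun_mul, starFun_mul, starFun_starFun]
  have h1 : starFun (fun _ => ((-c) • (1 : CMat N)).conjTranspose) z = (-c) • (1 : CMat N) := by
    simp [starFun]
  have h2 : ((-c) • (1 : CMat N)).conjTranspose = c • 1 := by
    rw [Matrix.conjTranspose_smul, Matrix.conjTranspose_one]
    congr 1
    rw [star_neg]
    exact neg_eq_iff_eq_neg.2 conj_inv_two_pi_I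
  beta_reduce
  rw [h1, h2]
  simp only [smul_mul_assoc, mul_smul_comm, one_mul, mul_one, smul_neg, neg_smul, smul_add,
    neg_mul, mul_assoc]
  abel

/-- The lower left block. -/
theorem lowerLeft_asymptotics (hP : IsMOPRL W P κ) (hG : G.natDegree ≤ m)
    {n : ℕ} {d : ℂ → CMat N} (hd : HasExpansion d
      fun l => gammaM κ n * bCoeff W P n ((l : ℤ) - 1)) {c : ℂ → CMat N}
    (hc : ∀ z : ℂ, z.im ≠ 0 → c z =
      (-(2 * Real.pi * Complex.I) : ℂ) • (gammaM κ n * evalM (P n) z)) :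
    EntrywiseBigO (fun z => c z * evalM G z * starFun d z
        - d z * starFun (evalM G) z * starFun c z - lowerLeft W P κ m G (n + 1) z)
      fun z => z ^ (-1 : ℤ) := by
  have h := ((entrywiseBigO_const (gammaM κ n) le_rfl).mul_zpow (hd.sub_sumDelta (J := m)
    (hP.natDegree_le n) hG (by omega) le_rfl) (c := -1) (by simp)).const_smul
      (-(2 * Real.pi * Complex.I))
  refine (h.sub h.star).congr' fun z hz => ?_
  have hcs : starFun c z =
      (2 * Real.pi * Complex.I : ℂ) • (starFun (evalM (P n)) z * gammaM κ n) := by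
    rw [starFun, hc _ (by simpa using hz), Matrix.conjTranspose_smul, Matrix.conjTranspose_mul,
      gammaM_conjTranspose, star_neg]
    congr 1
    exact neg_eq_iff_eq_neg.2 conj_two_pi_I
  have h1 : ∀ A : CMat N, starFun (fun _ => A) z = A.conjTranspose := fun A => rfl
  rw [hcs, hc z hz, lowerLeft, calA_eq_sumDelta, starFun_smul, starFun_mul, starFun_sub,
    starFun_mul, starFun_mul, starFun_mul, starFun_starFun]
  beta_reduce
  rw [h1, h1, gammaM_conjTranspose, gammaM_conjTranspose, map_neg, conj_two_pi_I]
  simp only [smul_mul_assoc, mul_smul_comm, smul_neg, neg_smul, mul_add, add_mul, mul_sub,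
    sub_mul, smul_sub, smul_add, neg_neg, neg_mul, mul_assoc]
  abel

/-- The upper left block. -/
theorem upperLeft_asymptotics (hP : IsMOPRL W P κ) (hG : G.natDegree ≤ m)
    {n : ℕ} {b : ℂ → CMat N} (hb : HasExpansion b
      fun l => (-(1 / (2 * Real.pi * Complex.I)) : ℂ) • bCoeff W P (n + 1) ((l : ℤ) - 1))
    {d : ℂ → CMat N} (hd : HasExpansion d
      fun l => gammaM κ n * bCoeff W P n ((l : ℤ) - 1)) {c : ℂ → CMat N}
    (hc : ∀ z : ℂ, z.im ≠ 0 → c z =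
      (-(2 * Real.pi * Complex.I) : ℂ) • (gammaM κ n * evalM (P n) z)) :
    EntrywiseBigO (fun z => evalM (P (n + 1)) z * evalM G z * starFun d z
        - b z * starFun (evalM G) z * starFun c z - -calB W P κ m G (n + 1) z)
      fun z => z ^ (-1 : ℤ) := by
  have hb' : HasExpansion b fun l => ((-(1 / (2 * Real.pi * Complex.I)) : ℂ) • (1 : CMat N)) *
      bCoeff W P (n + 1) ((l : ℤ) - 1) := by
    simpa using hb
  have h1 := hd.sub_sumDelta (J := m + 1) (hP.natDegree_le (n + 1)) hG le_rfl (by omega)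
  -- The range `j ≤ m` overshoots here, since `b_{n+1,n+m-1-j}` already vanishes for `j ≥ m - 1`; it
  -- matches the common range in the formula for `B_{n+1}`.
  have h2 := (hb'.sub_sumDelta (n := n) (J := m + 1) (hP.natDegree_le n) hG le_rfl (by omega)).star
  have h3 := (h2.mul_zpow (entrywiseBigO_const (gammaM κ n) le_rfl) (c := -1)
    (by simp)).const_smul (2 * Real.pi * Complex.I)
  refine (h1.sub h3).congr' fun z hz => ?_
  have hcs : starFun c z =
      (2 * Real.pi * Complex.I : ℂ) • (starFun (evalM (P n)) z * gammaM κ n) := by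
    rw [starFun, hc _ (by simpa using hz), Matrix.conjTranspose_smul, Matrix.conjTranspose_mul,
      gammaM_conjTranspose, star_neg]
    congr 1
    exact neg_eq_iff_eq_neg.2 conj_two_pi_I
  have h4 : starFun (fun _ => ((-(1 / (2 * Real.pi * Complex.I)) : ℂ) •
      (1 : CMat N)).conjTranspose) z = (-(1 / (2 * Real.pi * Complex.I)) : ℂ) • (1 : CMat N) := by
    rw [starFun, Matrix.conjTranspose_conjTranspose]
  rw [hcs, calB_eq_sumDelta, starFun_sub, starFun_mul, starFun_mul, starFun_mul, starFun_starFun]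
  beta_reduce
  rw [h4, gammaM_conjTranspose]
  have h5 : (2 * Real.pi * Complex.I : ℂ) * (1 / (2 * Real.pi * Complex.I)) = 1 :=
    mul_one_div_cancel two_pi_I_ne_zero
  have h6 : ((n + 1 : ℕ) : ℤ) + m - 1 = n + m := by push_cast; ring
  generalize (2 * Real.pi * Complex.I : ℂ) = β at h5 ⊢
  simp only [smul_mul_assoc, one_mul, smul_neg, neg_smul, add_mul, mul_smul_comm,
    sub_mul, smul_sub, neg_neg, neg_mul, mul_assoc, smul_smul, h5, one_smul, h6]
  abel

/-- `Y diag(G, -G^*) Y⁻¹` agrees with `F_n` up to `O(1 / z)`. -/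
theorem FMat_asymptotics (hW : IsWeight W) (hP : IsMOPRL W P κ) (hG : G.natDegree ≤ m)
    {n : ℕ} {a b c d : ℂ → CMat N} (ha : ∀ z : ℂ, z.im ≠ 0 → a z = evalM (P n) z)
    (hb : HasExpansion b
      fun l => (-(1 / (2 * Real.pi * Complex.I)) : ℂ) • bCoeff W P n ((l : ℤ) - 1))
    (h11 : EntrywiseBigO (fun z => evalM (P n) z * evalM G z * starFun d z
        - b z * starFun (evalM G) z * starFun c z - -calB W P κ m G n z) fun z => z ^ (-1 : ℤ))
    (h21 : EntrywiseBigO (fun z => c z * evalM G z * starFun d z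
        - d z * starFun (evalM G) z * starFun c z - lowerLeft W P κ m G n z)
      fun z => z ^ (-1 : ℤ)) :
    EntrywiseBigO (fun z => Matrix.fromBlocks (a z) (b z) (c z) (d z) *
      Matrix.fromBlocks (evalM G z) 0 0 (-starFun (evalM G) z) *
      Matrix.fromBlocks (starFun d z) (starFun b z) (starFun c z) (starFun a z)
      - FMat W P κ m G n z) fun z => z ^ (-1 : ℤ) := by
  -- The lower right block is minus the star of the upper left one, so its estimate follows by
  -- symmetry.
  refine (h11.fromBlocks (upperRight_asymptotics hW hP hG hb) h21 h11.star.neg).congr' fun z hz => ?_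
  have has : starFun a z = starFun (evalM (P n)) z := by
    rw [starFun, ha _ (by simpa using hz), starFun]
  rw [Matrix.fromBlocks_multiply, Matrix.fromBlocks_multiply, FMat, sub_eq_add_neg
      (Matrix.fromBlocks _ _ _ _), Matrix.fromBlocks_neg, Matrix.fromBlocks_add, has, ha z hz]
  simp only [starFun_sub, starFun_neg, starFun_mul, starFun_starFun]
  simp only [mul_zero, add_zero, zero_add, mul_neg, neg_mul, mul_assoc, sub_eq_add_neg]
  congr 1
  abel

theorem IsMOPRL.evalM_zero (hP : IsMOPRL W P κ) (z : ℂ) : evalM (P 0) z = 1 := by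
  rw [evalM_eq_sum_range (hP.natDegree_le 0)]
  simp [hP.monic]

end CoefficientMatrix

/-! ### Inverse and logarithmic derivative of `Y`, and the differential equation. -/

section LaxEquation

variable {N : ℕ}

theorem HasEDerivAt.entrywiseDiffOn {ι κ : Type*} {F F' : ℂ → Matrix ι κ ℂ} {s : Set ℂ}
    (h : ∀ z ∈ s, HasEDerivAt F (F' z) z) : EntrywiseDiffOn F s :=
  fun i j z hz => (h z hz i j).differentiableAt.differentiableWithinAt

theorem flipFun_sub_one (F : ℂ → BMat N) :
    flipFun (fun z => F z - 1) = fun z => flipFun F z - 1 := by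
  funext z
  ext (i | i) (j | j)
  · rcases eq_or_ne i j with rfl | h
    · simp [flipFun]
    · simp [flipFun, h]
  · simp [flipFun]
  · simp [flipFun]
  · rcases eq_or_ne i j with rfl | h
    · simp [flipFun]
    · simp [flipFun, h]

/-- The normalizing factor `diag(z ^ {-n}, z ^ n)`. -/
noncomputable def scaling (N n : ℕ) (z : ℂ) : BMat N :=
  Matrix.fromBlocks (z ^ (-(n : ℤ)) • (1 : CMat N)) 0 0 (z ^ (n : ℤ) • (1 : CMat N))

/-- `diag(-I, I)`. -/
def gradingM (N : ℕ) : BMat N := Matrix.fromBlocks (-1) 0 0 1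

theorem scaling_mul_flipFun (n : ℕ) {z : ℂ} (hz : z ≠ 0) :
    scaling N n z * flipFun (scaling N n) z = 1 := by
  have h : flipFun (scaling N n) z =
      Matrix.fromBlocks (z ^ (n : ℤ) • (1 : CMat N)) 0 0 (z ^ (-(n : ℤ)) • (1 : CMat N)) := by
    change flipFun (fun z => Matrix.fromBlocks _ _ _ _) z = _
    rw [flipFun_fromBlocks]
    simp [starFun, Matrix.conjTranspose_smul]
  rw [h, scaling, Matrix.fromBlocks_multiply]
  simp only [mul_zero, zero_mul, add_zero, zero_add, smul_mul_smul_comm, mul_one,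
    ← zpow_add₀ hz, neg_add_cancel, add_neg_cancel, zpow_zero, one_smul]
  exact Matrix.fromBlocks_one

theorem hasEDerivAt_scaling (n : ℕ) {z : ℂ} (hz : z ≠ 0) :
    HasEDerivAt (scaling N n) (scaling N n z * (((n : ℂ) * z⁻¹) • gradingM N)) z := by
  have hs : ∀ k : ℤ, HasEDerivAt (fun z : ℂ => z ^ k • (1 : CMat N))
      ((k * z ^ (k - 1)) • (1 : CMat N)) z := fun k i j => by
    simp only [Matrix.smul_apply, smul_eq_mul]
    exact (hasDerivAt_zpow k z (Or.inl hz)).mul_const _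
  have h := (hs (-n)).fromBlocks (HasEDerivAt.const (0 : CMat N) z)
    (HasEDerivAt.const (0 : CMat N) z) (hs n)
  have hk : ∀ k : ℤ, z ^ (k - 1) = z ^ k * z⁻¹ := fun k => by
    rw [zpow_sub₀ hz, zpow_one, div_eq_mul_inv]
  rw [hk, hk] at h
  have e : scaling N n z * (((n : ℂ) * z⁻¹) • gradingM N) = Matrix.fromBlocks
      (((-(n : ℤ) : ℤ) * (z ^ (-(n : ℤ)) * z⁻¹) : ℂ) • (1 : CMat N)) 0 0
      (((n : ℤ) * (z ^ (n : ℤ) * z⁻¹) : ℂ) • (1 : CMat N)) := by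
    rw [scaling, gradingM, Matrix.fromBlocks_smul, Matrix.fromBlocks_multiply]
    simp only [mul_zero, zero_mul, add_zero, zero_add, smul_zero, smul_mul_smul_comm, mul_one,
      mul_neg, smul_neg, neg_zero, Int.cast_neg, Int.cast_natCast]
    congr 1
    · rw [← neg_smul]; congr 1; ring
    · rw [mul_left_comm]
  rw [e]
  exact h

/-- The entrywise derivative of a matrix function. -/
noncomputable def entryDeriv (F : ℂ → BMat N) (z : ℂ) : BMat N :=
  Matrix.of fun i j => deriv (fun w => F w i j) z

theorem EntrywiseDiffOn.entryDeriv {F : ℂ → BMat N} (hF : EntrywiseDiffOn F Set.univ) :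
    EntrywiseDiffOn (entryDeriv F) Set.univ :=
  fun i j => (hF i j).deriv isOpen_univ

variable {W : ℝ → CMat N} {n : ℕ} {Y : ℂ → BMat N}

theorem IsRHPSolution.normalized_sub_one (hY : IsRHPSolution W n Y) :
    EntrywiseBigO (fun z => Y z * scaling N n z - 1) fun z => z ^ (-1 : ℤ) := by
  obtain ⟨Yc, h0, h⟩ := hY.exists_expansion
  simpa [h0, scaling] using h 0

theorem IsRHPSolution.normalized_isBigO_one (hY : IsRHPSolution W n Y) :
    EntrywiseBigO (fun z => Y z * scaling N n z) fun z => z ^ (0 : ℤ) := by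
  simpa using (hY.normalized_sub_one.trans (isBigO_zpow_mono (by norm_num))).add
    (entrywiseBigO_const (1 : BMat N) le_rfl)

/-- The normalization is inverse to its own flip, so it drops out of such products and bounded
normalized factors may be used instead. -/
theorem mul_scaling_mul_flipFun {F H : ℂ → BMat N} (n : ℕ) {z : ℂ} (hz : z ≠ 0) :
    F z * scaling N n z * flipFun (fun z => H z * scaling N n z) z = F z * flipFun H z := by
  rw [flipFun_mul, mul_assoc, ← mul_assoc (scaling N n z), scaling_mul_flipFun n hz, one_mul]

/-- For the normalized `A = I + O(1/z)` one writes `A A^♭ - I = (A - I) A^♭ + (A - I)^♭`, with `♭`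
the flip. -/
theorem IsRHPSolution.mul_flipFun_sub_one (hY : IsRHPSolution W n Y) :
    EntrywiseBigO (fun z => Y z * flipFun Y z - 1) fun z => z ^ (-1 : ℤ) := by
  have h1 := hY.normalized_sub_one
  have h2 := hY.normalized_isBigO_one
  have h3 := h1.flip
  rw [flipFun_sub_one] at h3
  refine ((h1.mul_zpow h2.flip (c := -1) (by simp)).add h3).congr' fun z hz => ?_
  rw [sub_mul, mul_scaling_mul_flipFun n (ne_zero_of_im_ne_zero hz), one_mul]
  abel

/-- The logarithmic derivative of the solution is `O(1 / |Im z|)`. -/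
theorem IsRHPSolution.entryDeriv_mul_flipFun (hY : IsRHPSolution W n Y) :
    EntrywiseBigO (fun z => entryDeriv Y z * flipFun Y z) fun z => ((z.im : ℂ))⁻¹ := by
  have h2 := hY.normalized_isBigO_one
  have hYd : ∀ z : ℂ, z.im ≠ 0 → HasEDerivAt Y (entryDeriv Y z) z := fun z hz =>
    EntrywiseDiffOn.hasEDerivAt isOpen_im_ne_zero hY.analytic hz
  have hAd : ∀ z : ℂ, z.im ≠ 0 → HasEDerivAt (fun z => Y z * scaling N n z)
      (entryDeriv Y z * scaling N n z + Y z * (scaling N n z * (((n : ℂ) * z⁻¹) • gradingM N))) z :=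
    fun z hz => (hYd z hz).mul (hasEDerivAt_scaling n (ne_zero_of_im_ne_zero hz))
  -- The normalized solution is bounded, so Cauchy's estimate gives this weaker rate; the derivative
  -- of the normalization itself contributes only `O(1/z)`.
  have h4 : EntrywiseBigO (entryDeriv fun z => Y z * scaling N n z) fun z => ((z.im : ℂ))⁻¹ :=
    fun i j => isBigO_deriv_inv_im
      (HasEDerivAt.entrywiseDiffOn (s := {z : ℂ | z.im ≠ 0}) hAd i j) (h2 i j)
  have h5 : EntrywiseBigO (fun z : ℂ => ((n : ℂ) * z⁻¹) • gradingM N) fun z => z ^ (-1 : ℤ) := by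
    have := (entrywiseBigO_zpow_smul (gradingM N) (a := -1) le_rfl).const_smul (n : ℂ)
    simpa [smul_smul] using this
  have h6 := ((h2.mul_zpow h5 (c := -1) (by simp)).mul_zpow h2.flip (c := -1) (by simp)).trans
    isBigO_zpow_neg_one_inv_im
  have h7 := h4.mul h2.flip
  simp only [zpow_zero, mul_one] at h7
  refine (h7.sub h6).congr' fun z hz => ?_
  have h8 : entryDeriv (fun z => Y z * scaling N n z) z =
      entryDeriv Y z * scaling N n z + Y z * (scaling N n z * (((n : ℂ) * z⁻¹) • gradingM N)) := by
    ext i j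
    exact (hAd z hz i j).deriv
  rw [h8, add_mul, mul_scaling_mul_flipFun n (ne_zero_of_im_ne_zero hz), ← mul_assoc (Y z)]
  abel

theorem entrywiseDiffOn_FMat (P : ℕ → (CMat N)[X]) (κ : ℕ → CMat N) {m : ℕ} {G : (CMat N)[X]}
    (hG : G.natDegree ≤ m) (n : ℕ) : EntrywiseDiffOn (FMat W P κ m G n) Set.univ := by
  have h : ∀ {d : ℕ} {f : ℂ → CMat N}, IsMatPoly d f → EntrywiseDiffOn f Set.univ :=
    fun hf => entrywiseDiffOn_univ hf.differentiable
  exact (h (isMatPoly_calB W P κ m hG n).neg).fromBlocks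
    (h (((isMatPoly_calA W P κ m G n).mul_left _).smul _).neg)
    (h (isMatPoly_lowerLeft W P κ m G n)) (h (isMatPoly_calB W P κ m hG n).star)

/-- The differential equation for `X^n`. -/
theorem IsRHPSolution.hasEDerivAt_XFun (hW : IsWeight W) {P : ℕ → (CMat N)[X]} {κ : ℕ → CMat N}
    (hP : IsMOPRL W P κ) {m : ℕ} {G : (CMat N)[X]} (hG : G.natDegree ≤ m)
    (hY : IsRHPSolution W n Y) {T S : ℂ → CMat N}
    (hT : ∀ z, HasEDerivAt T (evalM G z * T z) z) (hS : ∀ z, HasEDerivAt S (-(S z * evalM G z)) z)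
    (hST : ∀ z, S z * T z = 1) (hWT : ∀ x : ℝ, W x = T x * (T x).conjTranspose) {z : ℂ}
    (hz : z.im ≠ 0) :
    HasEDerivAt (XFun Y T) (FMat W P κ m G n z * XFun Y T z) z := by
  have hTd : EntrywiseDiffOn T Set.univ := HasEDerivAt.entrywiseDiffOn fun z _ => hT z
  have hSd : EntrywiseDiffOn S Set.univ := HasEDerivAt.entrywiseDiffOn fun z _ => hS z
  obtain ⟨Yu, Yl, hYu, hYl, hu, hl, hj⟩ := hY.exists_entire_branches hTd hSd hST hWT
  set V : ℂ → CMat N := fun z => T z * starFun T z with hV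
  have hVW : ∀ x : ℝ, V x = W x := fun x => by
    simp only [hV, starFun, Complex.conj_ofReal, hWT]
  set B : ℂ → BMat N := fun z => Matrix.fromBlocks 1 (V z) 0 1 with hB
  set L : ℂ → BMat N := fun z => Matrix.fromBlocks (evalM G z) 0 0 (-starFun (evalM G) z) with hL
  -- `T T^*` is its own star; this invariance is what cancels the jump of `Y * flipFun Y`.
  have hflipB : flipFun B = B := by
    have hs1 : starFun (fun _ : ℂ => (1 : CMat N)) = fun _ => 1 := by funext z; simp [starFun]
    rw [hB, flipFun_fromBlocks, hV, starFun_mul, starFun_starFun, hs1, starFun_zero]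
  have hju : Yu = fun z => Yl z * B z := funext hj
  have hflip : ∀ z, flipFun Yu z = B z * flipFun Yl z := fun z => by
    rw [hju, flipFun_mul, hflipB]
  -- the values off the real line
  have hval : ∀ z : ℂ, z.im ≠ 0 → (Y z = Yu z ∧ entryDeriv Y z = entryDeriv Yu z ∧
      flipFun Y z = flipFun Yl z) ∨ (Y z = Yl z ∧ entryDeriv Y z = entryDeriv Yl z ∧
      flipFun Y z = flipFun Yu z) := by
    have hopen1 : IsOpen {z : ℂ | 0 < z.im} := isOpen_lt continuous_const Complex.continuous_im
    have hopen2 : IsOpen {z : ℂ | z.im < 0} := isOpen_lt Complex.continuous_im continuous_const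
    intro z hz
    -- The flip evaluates at `z̄`, so each branch of `Y` is paired with the flip of the opposite
    -- branch.
    rcases lt_or_gt_of_ne hz with h | h
    · refine Or.inr ⟨hl z h, ?_, ?_⟩
      · ext i j
        refine Filter.EventuallyEq.deriv_eq ?_
        filter_upwards [hopen2.mem_nhds h] with w hw
        rw [hl w hw]
      · rw [flipFun, flipFun, hu _ (by simpa using h)]
    · refine Or.inl ⟨hu z h, ?_, ?_⟩
      · ext i j
        refine Filter.EventuallyEq.deriv_eq ?_
        filter_upwards [hopen1.mem_nhds h] with w hw
        rw [hu w hw]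
      · rw [flipFun, flipFun, hl _ (by simpa using h)]
  -- the inverse of the solution
  have hE : ∀ z : ℂ, z.im ≠ 0 → Y z * flipFun Y z = Yl z * (B z * flipFun Yl z) := by
    intro z hz
    rcases hval z hz with ⟨h1, -, h3⟩ | ⟨h1, -, h3⟩
    · rw [h1, h3, hj, mul_assoc]
    · rw [h1, h3, hflip]
  have hBd : EntrywiseDiffOn B Set.univ := (entrywiseDiffOn_const _ _).fromBlocks
    (hTd.mul hTd.starFun) (entrywiseDiffOn_const _ _) (entrywiseDiffOn_const _ _)
  have hE1 : ∀ z : ℂ, z.im ≠ 0 → Y z * flipFun Y z = 1 := by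
    intro z hz
    have h := EntrywiseBigO.eq_zero (F := fun z => Yl z * (B z * flipFun Yl z) - 1)
      ((hYl.mul (hBd.mul hYl.flip)).sub (entrywiseDiffOn_const 1 _)).differentiable
      ((hY.mul_flipFun_sub_one.congr' fun z hz => by rw [hE z hz]).trans
        isBigO_zpow_neg_one_inv_im) z
    rw [hE z hz]
    exact sub_eq_zero.1 h
  -- the logarithmic derivative is entire
  have hsT : ∀ z, HasEDerivAt (starFun T) (starFun T z * starFun (evalM G) z) z := fun z => by
    have h := HasEDerivAt.starFun (F := T) (F' := fun z => evalM G z * T z) (z := z) (hT _)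
    rwa [starFun_mul] at h
  -- The upper right entry is `V' = G V + V G^*`. In commutator form it shows that `Y' + Y L` has
  -- the same jump `B` as `Y`.
  have hBder : ∀ z, HasEDerivAt B (L z * B z - B z * L z) z := by
    intro z
    have h := (HasEDerivAt.const (1 : CMat N) z).fromBlocks ((hT z).mul (hsT z))
      (HasEDerivAt.const (0 : CMat N) z) (HasEDerivAt.const (1 : CMat N) z)
    convert h using 1
    simp only [hL, hB, hV, Matrix.fromBlocks_multiply, sub_eq_add_neg, Matrix.fromBlocks_neg,
      Matrix.fromBlocks_add]
    simp [mul_assoc]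
  have hYud : ∀ z, entryDeriv Yu z =
      entryDeriv Yl z * B z + Yl z * (L z * B z - B z * L z) := by
    intro z
    refine HasEDerivAt.unique (EntrywiseDiffOn.hasEDerivAt isOpen_univ hYu (Set.mem_univ z)) ?_
    rw [hju]
    exact (EntrywiseDiffOn.hasEDerivAt isOpen_univ hYl (Set.mem_univ z)).mul (hBder z)
  have hR : ∀ z : ℂ, z.im ≠ 0 → (entryDeriv Y z + Y z * L z) * flipFun Y z =
      (entryDeriv Yl z + Yl z * L z) * flipFun Yu z := by
    intro z hz
    rcases hval z hz with ⟨h1, h2, h3⟩ | ⟨h1, h2, h3⟩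
    · rw [h1, h2, h3, hYud, hflip, hj]
      simp only [mul_sub, add_mul, mul_assoc, sub_mul]
      abel
    · rw [h1, h2, h3]
  have hGd : EntrywiseDiffOn (evalM G) Set.univ :=
    entrywiseDiffOn_univ (isMatPoly_evalM (Nat.lt_succ_self _)).differentiable
  have hLd : EntrywiseDiffOn L Set.univ := hGd.fromBlocks (entrywiseDiffOn_const _ _)
    (entrywiseDiffOn_const _ _) fun i j => (hGd.starFun i j).neg
  -- identification of the logarithmic derivative
  obtain ⟨ha, hb⟩ := hY.first_row hW hP hYu hYl hu hl hj hVW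
  have hblocks : (fun z => Matrix.fromBlocks (Y z).toBlocks₁₁ (Y z).toBlocks₁₂ (Y z).toBlocks₂₁
      (Y z).toBlocks₂₂) = Y := funext fun z => Matrix.fromBlocks_toBlocks _
  have hF : EntrywiseBigO (fun z => Y z * L z * flipFun Y z - FMat W P κ m G n z)
      fun z => z ^ (-1 : ℤ) := by
    have key := FMat_asymptotics (m := m) (G := G) hW hP hG ha hb
      (c := fun z => (Y z).toBlocks₂₁) (d := fun z => (Y z).toBlocks₂₂)
    have hflipY := flipFun_fromBlocks (fun z => (Y z).toBlocks₁₁) (fun z => (Y z).toBlocks₁₂)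
      (fun z => (Y z).toBlocks₂₁) (fun z => (Y z).toBlocks₂₂)
    rw [hblocks] at hflipY
    have hgoal : (fun z => Y z * L z * flipFun Y z - FMat W P κ m G n z) = fun z =>
      Matrix.fromBlocks (Y z).toBlocks₁₁ (Y z).toBlocks₁₂ (Y z).toBlocks₂₁ (Y z).toBlocks₂₂ * L z *
        Matrix.fromBlocks (starFun (fun z => (Y z).toBlocks₂₂) z)
          (starFun (fun z => (Y z).toBlocks₁₂) z) (starFun (fun z => (Y z).toBlocks₂₁) z)
          (starFun (fun z => (Y z).toBlocks₁₁) z) - FMat W P κ m G n z := by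
      funext z
      rw [Matrix.fromBlocks_toBlocks, hflipY]
    rw [hgoal]
    rcases n with _ | n
    · obtain ⟨hc, hd⟩ := hY.second_row_zero hW hYu hYl hu hl hj hVW
      have hc' : ∀ z : ℂ, z.im ≠ 0 → starFun (fun z => (Y z).toBlocks₂₁) z = 0 := fun z hz => by
        rw [starFun, hc _ (by simpa using hz), Matrix.conjTranspose_zero]
      have hGm := (isMatPoly_evalM (Nat.lt_succ_of_le hG)).entrywiseBigO
      -- For `n = 0`, `Y₂₂ = I + O(z^{-m-1})` beats the growth `z^m` of `G`, so the upper left block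
      -- has polynomial part `G = -B_0`.
      refine key ((hGm.mul_zpow (hd.star m) (c := -1) (by omega)).congr' fun z hz => ?_)
        ((entrywiseBigO_zpow_smul (0 : CMat N) le_rfl).congr' fun z hz => ?_)
      · rw [hc' z hz, hP.evalM_zero, Finset.sum_range_succ', Finset.sum_eq_zero]
        · simp [calB, mul_sub]
        · intro l _; simp
      · rw [hc' z hz]
        rw [hc z hz]
        simp [lowerLeft]
    · obtain ⟨hc, hd⟩ := hY.second_row_succ hW hP hYu hYl hu hl hj hVW
      exact key (upperLeft_asymptotics hP hG hb hd hc) (lowerLeft_asymptotics hP hG hd hc)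
  -- The expression in `Yl` and `flipFun Yu` is the entire form of the logarithmic derivative. Off
  -- the real line its difference from `F_n` is `Y' Y⁻¹` plus an `O(1/z)` term, both `O(1 / |Im
  -- z|)`, so Liouville applies.
  have hRF : (entryDeriv Y z + Y z * L z) * flipFun Y z = FMat W P κ m G n z := by
    have h := EntrywiseBigO.eq_zero
      (F := fun z => (entryDeriv Yl z + Yl z * L z) * flipFun Yu z - FMat W P κ m G n z)
      (((hYl.entryDeriv.add (hYl.mul hLd)).mul hYu.flip).sub
        (entrywiseDiffOn_FMat P κ hG n)).differentiable
      ((hY.entryDeriv_mul_flipFun.add (hF.trans isBigO_zpow_neg_one_inv_im)).congr'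
        fun z hz => by rw [← hR z hz, add_mul]; abel) z
    rw [hR z hz]
    exact sub_eq_zero.1 h
  -- the equation for `X`
  set D : ℂ → BMat N := fun z => Matrix.fromBlocks (T z) 0 0 (starFun S z) with hD
  have hX : XFun Y T = fun z => Y z * D z := by
    funext z
    have h : starFun S z * starFun T z = 1 := by
      rw [starFun, starFun, ← Matrix.conjTranspose_mul, mul_eq_one_comm.1 (hST _),
        Matrix.conjTranspose_one]
    rw [XFun, Matrix.inv_eq_left_inv h]
  have hDder : HasEDerivAt D (L z * D z) z := by
    have hsS : HasEDerivAt (starFun S) (-(starFun (evalM G) z * starFun S z)) z := by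
      have h := HasEDerivAt.starFun (F := S) (F' := fun z => -(S z * evalM G z)) (z := z) (hS _)
      rwa [starFun_neg, starFun_mul] at h
    have h := (hT z).fromBlocks (HasEDerivAt.const (0 : CMat N) z)
      (HasEDerivAt.const (0 : CMat N) z) hsS
    convert h using 1
    simp [hL, hD, Matrix.fromBlocks_multiply]
  have hYd : HasEDerivAt Y (entryDeriv Y z) z :=
    EntrywiseDiffOn.hasEDerivAt isOpen_im_ne_zero hY.analytic hz
  rw [hX, ← hRF]
  convert hYd.mul hDder using 1
  rw [mul_assoc _ (flipFun Y z), ← mul_assoc (flipFun Y z), mul_eq_one_comm.1 (hE1 z hz), one_mul,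
    add_mul, mul_assoc (Y z)]

end LaxEquation

/-! ### Assembly of the theorem. -/

theorem mainTheorem2 {N : ℕ} (W T : ℝ → CMat N) (hW : IsWeight W)
    (hWT : ∀ x, W x = T x * (T x).conjTranspose)
    (m : ℕ) (G : (CMat N)[X]) (hG : G.natDegree ≤ m)
    (hT : ∀ (x : ℝ) (i j : Fin N), HasDerivAt (fun t : ℝ => T t i j) ((evalM G x * T x) i j) x)
    (P : ℕ → (CMat N)[X]) (κ : ℕ → CMat N) (hP : IsMOPRL W P κ) :
    -- the entire invertible continuation of `T`, and the differential equation for `X^n`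
    (∃ Tc : ℂ → CMat N,
      (∀ i j, Differentiable ℂ fun z => Tc z i j) ∧
      (∀ x : ℝ, Tc x = T x) ∧
      (∀ z, IsUnit (Tc z)) ∧
      ∀ (n : ℕ) (Y : ℂ → BMat N), IsRHPSolution W n Y →
        ∀ z : ℂ, z.im ≠ 0 → ∀ i j,
          HasDerivAt (fun w => XFun Y Tc w i j) ((FMat W P κ m G n z * XFun Y Tc z) i j) z) ∧
    -- `A_n` and `B_n` are matrix polynomials of degree at most `m - 1` and `m`
    (∀ n : ℕ,
      (∃ Q : (CMat N)[X], Q.degree < m ∧ ∀ z, calA W P κ m G n z = evalM Q z) ∧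
      (∃ Q : (CMat N)[X], Q.degree ≤ m ∧ ∀ z, calB W P κ m G n z = evalM Q z)) ∧
    -- `F_n(z; G)` does not depend on the bound `m` chosen for the degree of `G`
    (∀ (m₁ m₂ : ℕ) (G₁ : (CMat N)[X]), G₁.natDegree ≤ m₁ → G₁.natDegree ≤ m₂ →
      ∀ (n : ℕ) (z : ℂ), FMat W P κ m₁ G₁ n z = FMat W P κ m₂ G₁ n z) ∧
    -- `F_n(z; G)` is (real-)linear in `G`
    (∀ (m₁ : ℕ) (G₁ G₂ : (CMat N)[X]), G₁.natDegree ≤ m₁ → G₂.natDegree ≤ m₁ →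
      ∀ (n : ℕ) (z : ℂ),
        FMat W P κ m₁ (G₁ + G₂) n z = FMat W P κ m₁ G₁ n z + FMat W P κ m₁ G₂ n z) ∧
    (∀ (m₁ : ℕ) (G₁ : (CMat N)[X]), G₁.natDegree ≤ m₁ →
      ∀ (c : ℝ) (n : ℕ) (z : ℂ), FMat W P κ m₁ (c • G₁) n z = c • FMat W P κ m₁ G₁ n z) := by
  refine ⟨?_, fun n => ⟨(isMatPoly_calA W P κ m G n).exists_polynomial, ?_⟩,
    fun m₁ m₂ G₁ h₁ h₂ n z => ?_, fun m₁ G₁ G₂ _ _ n z => FMat_add W P κ m₁ G₁ G₂ n z,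
    fun m₁ G₁ _ c n z => FMat_smul W P κ m₁ c G₁ n z⟩
  · have h0 : IsUnit (T 0) := by
      have h := (hW.posDef 0).isUnit
      rw [hWT 0] at h
      exact isUnit_of_mul_isUnit_left h
    obtain ⟨Tc, S, hTc, hTd, hSd, hST⟩ := exists_entire_continuation (T := T) hT h0
    refine ⟨Tc, fun i j z => (hTd z i j).differentiableAt, hTc,
      fun z => IsUnit.of_mul_eq_one _ (mul_eq_one_comm.1 (hST z)), fun n Y hY z hz => ?_⟩
    exact hY.hasEDerivAt_XFun hW hP hG hTd hSd hST (fun x => by rw [hTc, hWT]) hz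
  · obtain ⟨Q, hQ, hQe⟩ := (isMatPoly_calB W P κ m hG n).exists_polynomial
    refine ⟨Q, ?_, hQe⟩
    rw [← natDegree_le_iff_degree_le]
    by_cases h : Q = 0
    · simp [h]
    · exact Nat.lt_succ_iff.1 ((natDegree_lt_iff_degree_lt h).2 hQ)
  · rw [FMat_eq_of_natDegree_le W P κ h₁, FMat_eq_of_natDegree_le W P κ h₂]
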